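/- Let $n\ge 1$ and let $\eta,\lambda,\mu$ be real with $0<\eta<\lambda<\pi-\eta$ and $\eta-\lambda<\mu<\lambda-\eta$. **20V model with DWBC2.** Consider the nodes $(i,j)$, $1\le i,j\le n$, of the square lattice together with all horizontal edges $(i,j)\to(i+1,j)$, vertical edges $(i,j)\to(i,j-1)$ and diagonal edges $(i,j)\to(i+1,j-1)$ incident to at least one of them. A configuration is a set of occupied edges such that at each node as many occupied edges enter (from North, Northwest, West) as exit (to East, Southeast, South), the horizontal and diagonal edges of the left boundary and the vertical and diagonal edges of the bottom boundary being occupied, except for the upper left edge $(0,n+1)\to(1,n)$ and the lower right edge $(n,1)\to(n+1,0)$, and all other boundary edges being empty. At each node the $m$-th uppermost entering step (order North, Northwest, West) is followed by the $m$-th uppermost exiting step (order East, Southeast, South); this decomposes the occupied edges into non-crossing, possibly osculating paths. The weight of a configuration is the product of its node weights. A node with no path has weight $\omega_0$. A node with one path, written (entering, exiting), has weight $\omega_1$ for (N,S), $\omega_2$ for (NW,S) and (N,SE), $\omega_3$ for (NW,SE), $\omega_4$ for (W,S) and (N,E), $\omega_5$ for (W,SE) and (NW,E), $\omega_6$ for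 (W,E). Complementary environments (occupied and empty edges exchanged) have equal weights. Here $$\begin{aligned} \omega_0&=\sin(\lambda+\eta)\sin\tfrac{\lambda+3\eta+\mu}{2}\sin\tfrac{\lambda+3\eta-\mu}{2},& \omega_1&=\sin(\lambda-\eta)\sin\tfrac{\lambda-\eta+\mu}{2}\sin\tfrac{\lambda+3\eta-\mu}{2},\\ \omega_2&=\sin(2\eta)\sin(\lambda-\eta)\sin\tfrac{\lambda+3\eta-\mu}{2},& \omega_3&=\sin^3(2\eta)+\sin(\lambda+\eta)\sin\tfrac{\lambda-\eta+\mu}{2}\sin\tfrac{\lambda-\eta-\mu}{2},\\ \omega_4&=\sin(2\eta)\sin\tfrac{\lambda+3\eta+\mu}{2}\sin\tfrac{\lambda+3\eta-\mu}{2},& \omega_5&=\sin(2\eta)\sin(\lambda-\eta)\sin\tfrac{\lambda+3\eta+\mu}{2},\\ \omega_6&=\sin(\lambda-\eta)\sin\tfrac{\lambda+3\eta+\mu}{2}\sin\tfrac{\lambda-\eta-\mu}{2}. \end{aligned}$$ For $1\le L\le n$ let $\tilde Z^{|}_{n;L}$ (respectively $\tilde Z^{\diagdown}_{n;L}$) be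 the sum of the weights of the configurations whose uppermost path, which starts with the edge $(0,n)\to(1,n)$, leaves the horizontal line $j=n$ at the node $(L,n)$ by a vertical (respectively diagonal) step, and put $$\tilde Z^{|}_n(\tau)=\sum_{L=1}^n\tilde Z^{|}_{n;L}\,\tau^{L-1},\qquad \tilde Z^{\diagdown}_n(\tau)=\sum_{L=1}^n\tilde Z^{\diagdown}_{n;L}\,\tau^{L-1}.$$ **6V model with DWBC.** On the same nodes with the horizontal and vertical edges only, configurations, paths and weights are defined in the same way: left and bottom boundary edges are occupied, right and top ones are empty, as many path steps enter a node as exit it, and a node has weight $a=\sin(\lambda+\eta)$ if it carries no or two paths, $b=\sin(\lambda-\eta)$ if it carries one path going straight, $c=\sin(2\eta)$ if it carries one path that turns. Let $Z^{6V}_{n;L}$ be the sum of the weights of the configurations whose uppermost path hits the vertical line $i=n$ at the node $(n,L)$, and $Z^{6V}_n(\sigma)=\sum_{L=1}^nZ^{6V}_{n;L}\,\sigma^{L-1}$. **Theorem.** Let $q=e^{i\eta}$, $z=e^{i(\eta+\lambda)}$, $w=e^{-i(\eta+\lambda)}$, $t=e^{i\mu}$, $t^{1/3}=e^{i\mu/3}$,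 $\nu=1/(2i\,t^{1/3})$, $a_2=\nu(qz-q^{-1}t)$ and $a_3=\nu(qt-q^{-1}w)$. For every $\sigma\in\mathbb C$ with $$D:=\sigma\sin(\lambda-\eta)\sin\tfrac{\lambda-\eta+\mu}{2}-\sin(\lambda+\eta)\sin\tfrac{\lambda-5\eta+\mu}{2}\neq0,$$ one has $$\tilde Z^{|}_n(\tilde\tau)+\tilde g(\sigma)\,\tilde Z^{\diagdown}_n(\tilde\tau)=\left(\frac{a_2a_3}{t^{1/3}}\right)^{n^2}Z^{6V}_n(\sigma),$$ where $$\tilde\tau=\sigma\,\frac{\sigma\sin(\lambda-\eta)\sin\tfrac{\lambda+3\eta+\mu}{2}-\sin(\lambda+\eta)\sin\tfrac{\lambda-\eta+\mu}{2}}{D}\cdot\frac{\sin\tfrac{\lambda+3\eta-\mu}{2}}{\sin\tfrac{\lambda-\eta-\mu}{2}},\qquad \tilde g(\sigma)=\frac{\sigma\sin(2\eta)\sin\tfrac{\lambda+3\eta-\mu}{2}}{D}.$$ -/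

import Mathlib

/-!  # The 20V and 6V models with domain wall boundary conditions

Nodes of the `n × n` square are pairs `(i, j)` of `Fin n`; the pair `(i, j)` stands for the node with
integer coordinates `(i + 1, j + 1)`, so `i` numbers columns from left to right and `j` numbers rows
from bottom to top.  Configurations are given in the osculating path language: an edge is occupied
(`true`) exactly when it is oriented to the East, South-East or South. -/

namespace TwentyV

/-! ## Edge configurations on the triangular lattice -/

/-- The three directions from which a path step may enter a node, from upper to lower. -/
inductive Inc
  | north
  | northwest
  | west

/-- The three directions in which a path step may exit a node, from upper to lower. -/
inductive Out
  | east
  | southeast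
  | south

/-- Occupation numbers of the edges, as a triple `(h, v, d)` (coordinates below are the integer
coordinates of the nodes, which are `1, …, n`):
* `h k j` is the horizontal edge `(k, j + 1) → (k + 1, j + 1)`, `0 ≤ k ≤ n`;
* `v i l` is the vertical edge `(i + 1, l + 1) → (i + 1, l)`, `0 ≤ l ≤ n`;
* `d k l` is the diagonal edge `(k, l + 1) → (k + 1, l)`, `0 ≤ k, l ≤ n`.
The two slots `d 0 0` and `d n n` are incident to no node of the square: they are not edges, and
are set to `false` in the boundary conditions below. -/
abbrev Config (n : ℕ) : Type :=
  (Fin (n + 1) → Fin n → Bool) × (Fin n → Fin (n + 1) → Bool) × (Fin (n + 1) → Fin (n + 1) → Bool)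

variable {n : ℕ}

/-- Occupation of the edges entering the node `(i, j)`. -/
def inEdge (c : Config n) (i j : Fin n) : Inc → Bool
  | .north => c.2.1 i j.succ
  | .northwest => c.2.2 i.castSucc j.succ
  | .west => c.1 i.castSucc j

/-- Occupation of the edges exiting the node `(i, j)`. -/
def outEdge (c : Config n) (i j : Fin n) : Out → Bool
  | .east => c.1 i.succ j
  | .southeast => c.2.2 i.succ j.castSucc
  | .south => c.2.1 i j.castSucc

/-- The ice rule at `(i, j)`: as many ingoing as outgoing edges, that is, as many path steps enter
the node as exit it. -/
def IceRule (c : Config n) (i j : Fin n) : Prop :=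
  (inEdge c i j .north).toNat + (inEdge c i j .northwest).toNat + (inEdge c i j .west).toNat =
    (outEdge c i j .east).toNat + (outEdge c i j .southeast).toNat + (outEdge c i j .south).toNat

/-- The second domain wall boundary condition (DWBC2): the horizontal and diagonal edges of the left
boundary and the vertical and diagonal edges of the bottom boundary are occupied, except for the
upper left and the lower right diagonal edges; all other boundary edges are empty. -/
structure DWBC2 (c : Config n) : Prop where
  left : ∀ j, c.1 0 j = true
  right : ∀ j, c.1 (Fin.last n) j = false
  bottom : ∀ i, c.2.1 i 0 = true
  top : ∀ i, c.2.1 i (Fin.last n) = false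
  diagLeft : ∀ l, l ≠ 0 → l ≠ Fin.last n → c.2.2 0 l = true
  diagBottom : ∀ k, k ≠ 0 → k ≠ Fin.last n → c.2.2 k 0 = true
  diagTop : ∀ k, c.2.2 k (Fin.last n) = false
  diagRight : ∀ l, c.2.2 (Fin.last n) l = false
  noEdge : c.2.2 0 0 = false

/-- 20V configurations with DWBC2. -/
def IsConfig20V (c : Config n) : Prop :=
  DWBC2 c ∧ ∀ i j, IceRule c i j

/-! ## Paths -/

/-- Number of path steps entering `(i, j)` strictly above the given direction. -/
def inAbove (c : Config n) (i j : Fin n) : Inc → ℕ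
  | .north => 0
  | .northwest => (inEdge c i j .north).toNat
  | .west => (inEdge c i j .north).toNat + (inEdge c i j .northwest).toNat

/-- Number of path steps exiting `(i, j)` strictly above the given direction. -/
def outAbove (c : Config n) (i j : Fin n) : Out → ℕ
  | .east => 0
  | .southeast => (outEdge c i j .east).toNat
  | .south => (outEdge c i j .east).toNat + (outEdge c i j .southeast).toNat

/-- At each node, path steps are concatenated in the unique non-crossing way: the `m`-th uppermost
entering step is followed by the `m`-th uppermost exiting step. -/
def Continues (c : Config n) (i j : Fin n) (a : Inc) (b : Out) : Prop :=
  inEdge c i j a = true ∧ outEdge c i j b = true ∧ inAbove c i j a = outAbove c i j b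

/-- `OnUppermost c i j a`: the uppermost path, which starts with the horizontal edge
`(0, n) → (1, n)`, enters the node `(i, j)` through its edge of direction `a`. -/
inductive OnUppermost (c : Config n) : Fin n → Fin n → Inc → Prop
  | start (i j : Fin n) : i.val = 0 → j.val + 1 = n → OnUppermost c i j .west
  | east (i j i' : Fin n) (a : Inc) : OnUppermost c i j a → Continues c i j a .east →
      i'.val = i.val + 1 → OnUppermost c i' j .west
  | southeast (i j i' j' : Fin n) (a : Inc) : OnUppermost c i j a →
      Continues c i j a .southeast → i'.val = i.val + 1 → j'.val + 1 = j.val →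
      OnUppermost c i' j' .northwest
  | south (i j j' : Fin n) (a : Inc) : OnUppermost c i j a → Continues c i j a .south →
      j'.val + 1 = j.val → OnUppermost c i j' .north

/-- The uppermost path leaves the top horizontal line at the node of column `L`, and the step just
after that node is a vertical one (`b = south`) or a diagonal one (`b = southeast`). -/
def LeavesTop (c : Config n) (L : Fin n) (b : Out) : Prop :=
  b ≠ .east ∧ ∃ (j : Fin n) (a : Inc), j.val + 1 = n ∧ OnUppermost c L j a ∧ Continues c L j a b

/-! ## 20V partition functions -/

/-- The values `ω₀, …, ω₆` of the vertex weights. -/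
noncomputable def omega (η lam μ : ℂ) : Fin 7 → ℂ
  | 0 => Complex.sin (lam + η) * Complex.sin ((lam + 3 * η + μ) / 2) *
      Complex.sin ((lam + 3 * η - μ) / 2)
  | 1 => Complex.sin (lam - η) * Complex.sin ((lam - η + μ) / 2) *
      Complex.sin ((lam + 3 * η - μ) / 2)
  | 2 => Complex.sin (2 * η) * Complex.sin (lam - η) * Complex.sin ((lam + 3 * η - μ) / 2)
  | 3 => Complex.sin (2 * η) ^ 3 + Complex.sin (lam + η) * Complex.sin ((lam - η + μ) / 2) *
      Complex.sin ((lam - η - μ) / 2)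
  | 4 => Complex.sin (2 * η) * Complex.sin ((lam + 3 * η + μ) / 2) *
      Complex.sin ((lam + 3 * η - μ) / 2)
  | 5 => Complex.sin (2 * η) * Complex.sin (lam - η) * Complex.sin ((lam + 3 * η + μ) / 2)
  | 6 => Complex.sin (lam - η) * Complex.sin ((lam + 3 * η + μ) / 2) *
      Complex.sin ((lam - η - μ) / 2)

/-- The weight of a node as a function of the occupation of its edges
`north, northwest, west` (entering) and `east, southeast, south` (exiting): the dictionary from the
20 vertex environments to the seven values `ω₀, …, ω₆`.  (The last case is not an ice environment.) -/
def weight20V (ω : Fin 7 → ℂ) : (N NW W E SE S : Bool) → ℂ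
  -- no path
  | false, false, false, false, false, false => ω 0
  -- one path
  | true, false, false, false, false, true => ω 1
  | true, false, false, false, true, false => ω 2
  | true, false, false, true, false, false => ω 4
  | false, true, false, false, false, true => ω 2
  | false, true, false, false, true, false => ω 3
  | false, true, false, true, false, false => ω 5
  | false, false, true, false, false, true => ω 4
  | false, false, true, false, true, false => ω 5
  | false, false, true, true, false, false => ω 6
  -- two paths (complements of the preceding ones)
  | false, true, true, true, true, false => ω 1
  | false, true, true, true, false, true => ω 2
  | false, true, true, false, true, true => ω 4
  | true, false, true, true, true, false => ω 2
  | true, false, true, true, false, true => ω 3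
  | true, false, true, false, true, true => ω 5
  | true, true, false, true, true, false => ω 4
  | true, true, false, true, false, true => ω 5
  | true, true, false, false, true, true => ω 6
  -- three paths
  | true, true, true, true, true, true => ω 0
  | _, _, _, _, _, _ => 0

/-- The weight of a configuration: the product of the weights of its nodes. -/
def totalWeight20V (ω : Fin 7 → ℂ) (c : Config n) : ℂ :=
  ∏ i : Fin n, ∏ j : Fin n, weight20V ω
    (inEdge c i j .north) (inEdge c i j .northwest) (inEdge c i j .west)
    (outEdge c i j .east) (outEdge c i j .southeast) (outEdge c i j .south)

open Classical in
/-- Partition function of the 20V configurations with DWBC2 whose uppermost path leaves the top line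
in column `L`, with a following step of type `b`. -/
noncomputable def Ztop (n : ℕ) (ω : Fin 7 → ℂ) (b : Out) (L : Fin n) : ℂ :=
  ∑ c : Config n, if IsConfig20V c ∧ LeavesTop c L b then totalWeight20V ω c else 0

/-- The refined partition function: the generating function of `Ztop` with `τ ^ (L - 1)` for the
position `L = 1, …, n`. -/
noncomputable def ZtopRefined (n : ℕ) (ω : Fin 7 → ℂ) (b : Out) (τ : ℂ) : ℂ :=
  ∑ L : Fin n, Ztop n ω b L * τ ^ L.val

/-! ## The 6V model with DWBC -/

/-- Occupation numbers `(h, v)` of the edges of the square grid, with the same conventions as for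
the horizontal and vertical edges of `Config`. -/
abbrev Config6V (n : ℕ) : Type :=
  (Fin (n + 1) → Fin n → Bool) × (Fin n → Fin (n + 1) → Bool)

/-- Whether a path step enters a node of the square grid from the North or from the West. -/
inductive Inc6V
  | north
  | west

/-- Whether a path step exits a node of the square grid to the East or to the South. -/
inductive Out6V
  | east
  | south

/-- Occupation of the edges entering the node `(i, j)`. -/
def inEdge6V (c : Config6V n) (i j : Fin n) : Inc6V → Bool
  | .north => c.2 i j.succ
  | .west => c.1 i.castSucc j

/-- Occupation of the edges exiting the node `(i, j)`. -/
def outEdge6V (c : Config6V n) (i j : Fin n) : Out6V → Bool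
  | .east => c.1 i.succ j
  | .south => c.2 i j.castSucc

/-- 6V configurations with DWBC: the left and bottom boundary edges are occupied, the right and top
ones are empty, and the ice rule holds at each node. -/
structure IsConfig6V (c : Config6V n) : Prop where
  left : ∀ j, c.1 0 j = true
  right : ∀ j, c.1 (Fin.last n) j = false
  bottom : ∀ i, c.2 i 0 = true
  top : ∀ i, c.2 i (Fin.last n) = false
  ice : ∀ i j, (inEdge6V c i j .north).toNat + (inEdge6V c i j .west).toNat =
    (outEdge6V c i j .east).toNat + (outEdge6V c i j .south).toNat

/-- Number of path steps entering `(i, j)` strictly above the given direction. -/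
def inAbove6V (c : Config6V n) (i j : Fin n) : Inc6V → ℕ
  | .north => 0
  | .west => (inEdge6V c i j .north).toNat

/-- Number of path steps exiting `(i, j)` strictly above the given direction. -/
def outAbove6V (c : Config6V n) (i j : Fin n) : Out6V → ℕ
  | .east => 0
  | .south => (outEdge6V c i j .east).toNat

/-- The non-crossing concatenation of path steps at a node of the square grid. -/
def Continues6V (c : Config6V n) (i j : Fin n) (a : Inc6V) (b : Out6V) : Prop :=
  inEdge6V c i j a = true ∧ outEdge6V c i j b = true ∧ inAbove6V c i j a = outAbove6V c i j b

/-- The uppermost path, which starts with the horizontal edge `(0, n) → (1, n)`, enters the node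
`(i, j)` from the direction `a`. -/
inductive OnUppermost6V (c : Config6V n) : Fin n → Fin n → Inc6V → Prop
  | start (i j : Fin n) : i.val = 0 → j.val + 1 = n → OnUppermost6V c i j .west
  | east (i j i' : Fin n) (a : Inc6V) : OnUppermost6V c i j a → Continues6V c i j a .east →
      i'.val = i.val + 1 → OnUppermost6V c i' j .west
  | south (i j j' : Fin n) (a : Inc6V) : OnUppermost6V c i j a → Continues6V c i j a .south →
      j'.val + 1 = j.val → OnUppermost6V c i j' .north

/-- The uppermost path hits the last column at the node of row `L`: it enters this node by a
horizontal step. -/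
def HitsRight6V (c : Config6V n) (L : Fin n) : Prop :=
  ∃ i : Fin n, i.val + 1 = n ∧ OnUppermost6V c i L .west

/-- The weight of a node as a function of the occupation of its edges `north, west` (entering) and
`east, south` (exiting): `a` for no or two paths, `b` for a path going straight, `c` for a path that
turns.  (The last case is not an ice environment.) -/
def weight6V (a b c : ℂ) : (N W E S : Bool) → ℂ
  | false, false, false, false => a
  | true, true, true, true => a
  | true, false, false, true => b
  | false, true, true, false => b
  | true, false, true, false => c
  | false, true, false, true => c
  | _, _, _, _ => 0

open Classical in
/-- Partition function of the 6V configurations with DWBC whose uppermost path hits the last column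
in row `L`. -/
noncomputable def Z6V (n : ℕ) (a b c : ℂ) (L : Fin n) : ℂ :=
  ∑ e : Config6V n, if IsConfig6V e ∧ HitsRight6V e L then
    ∏ i : Fin n, ∏ j : Fin n, weight6V a b c
      (inEdge6V e i j .north) (inEdge6V e i j .west) (outEdge6V e i j .east) (outEdge6V e i j .south)
    else 0

/-- The refined 6V partition function, with `σ ^ (L - 1)` for the position `L = 1, …, n` and with
weights `a = sin (λ + η)`, `b = sin (λ - η)`, `c = sin (2 η)`. -/
noncomputable def Z6VRefined (n : ℕ) (η lam σ : ℂ) : ℂ :=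
  ∑ L : Fin n, Z6V n (Complex.sin (lam + η)) (Complex.sin (lam - η)) (Complex.sin (2 * η)) L *
    σ ^ L.val

/-! ## Parameters -/

/-- The cube root `t^{1/3} = e^{i μ / 3}` of the diagonal spectral parameter `t = e^{i μ}`. -/
noncomputable def tCubeRoot (μ : ℂ) : ℂ := Complex.exp (Complex.I * μ / 3)

/-- The weight `a₂ = ν (q z - q⁻¹ t)` of sub-lattice 2, where `ν = 1 / (2 i t^{1/3})`,
`q = e^{i η}`, `z = e^{i (η + λ)}`, `t = e^{i μ}`. -/
noncomputable def a₂ (η lam μ : ℂ) : ℂ :=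
  1 / (2 * Complex.I * tCubeRoot μ) *
    (Complex.exp (Complex.I * η) * Complex.exp (Complex.I * (η + lam)) -
      (Complex.exp (Complex.I * η))⁻¹ * Complex.exp (Complex.I * μ))

/-- The weight `a₃ = ν (q t - q⁻¹ w)` of sub-lattice 3, where `w = e^{-i (η + λ)}`. -/
noncomputable def a₃ (η lam μ : ℂ) : ℂ :=
  1 / (2 * Complex.I * tCubeRoot μ) *
    (Complex.exp (Complex.I * η) * Complex.exp (Complex.I * μ) -
      (Complex.exp (Complex.I * η))⁻¹ * Complex.exp (-(Complex.I * (η + lam))))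

/-- The common denominator of `τ̃` and `g̃`. -/
noncomputable def denomTilde (η lam μ σ : ℂ) : ℂ :=
  σ * Complex.sin (lam - η) * Complex.sin ((lam - η + μ) / 2) -
    Complex.sin (lam + η) * Complex.sin ((lam - 5 * η + μ) / 2)

/-- The argument `τ̃` as a function of `σ`. -/
noncomputable def tauTilde (η lam μ σ : ℂ) : ℂ :=
  σ * ((σ * Complex.sin (lam - η) * Complex.sin ((lam + 3 * η + μ) / 2) -
      Complex.sin (lam + η) * Complex.sin ((lam - η + μ) / 2)) / denomTilde η lam μ σ) *
    (Complex.sin ((lam + 3 * η - μ) / 2) / Complex.sin ((lam - η - μ) / 2))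

/-- The prefactor `g̃` as a function of `σ`. -/
noncomputable def gTilde (η lam μ σ : ℂ) : ℂ :=
  σ * Complex.sin (2 * η) * Complex.sin ((lam + 3 * η - μ) / 2) / denomTilde η lam μ σ

end TwentyV

/-!
The weight of a 20V node is that of a triangle of three six-vertex crossings, of its horizontal,
vertical and diagonal lines. By the Yang–Baxter equation the lines of a triangle may be moved across
the opposite crossing, so each diagonal line can be pushed off the square, through its upper right
corner or its lower left one. With DWBC2 it then crosses the other lines far from the square, where
all edges are in the same state and each crossing has weight `a`. What remains is the 6V model with
DWBC.

This holds with an arbitrary spectral parameter on each horizontal line. Changing that of the top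
line multiplies the straight weight of this line by `σ`. As the uppermost path determines the top
row, the change of the 20V weight depends only on the place and on the direction in which the path
leaves this row. The 6V model is refined by the top row in the same way, and a reflection in the
diagonal of the square turns the column where the uppermost path leaves the top row into the row
where it hits the last column.
-/

namespace TwentyV

section OrderedProducts

variable {M : Type*} [Monoid M]

/-- The ordered product `f a * f (a + 1) * ⋯ * f (a + m - 1)` in a monoid. -/
def orderedProd (f : ℕ → M) (a m : ℕ) : M :=
  ((List.range' a m).map f).prod

@[simp]
theorem orderedProd_zero (f : ℕ → M) (a : ℕ) : orderedProd f a 0 = 1 := rfl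

theorem orderedProd_succ_left (f : ℕ → M) (a m : ℕ) :
    orderedProd f a (m + 1) = f a * orderedProd f (a + 1) m := by
  simp only [orderedProd, List.range'_succ, List.map_cons, List.prod_cons]

theorem orderedProd_add (f : ℕ → M) (a m k : ℕ) :
    orderedProd f a (m + k) = orderedProd f a m * orderedProd f (a + m) k := by
  simp only [orderedProd, ← List.range'_append_1, List.map_append, List.prod_append]

theorem orderedProd_succ (f : ℕ → M) (a m : ℕ) :
    orderedProd f a (m + 1) = orderedProd f a m * f (a + m) := by
  rw [orderedProd_add, orderedProd_succ_left, orderedProd_zero, mul_one]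

theorem orderedProd_congr {f g : ℕ → M} {a m : ℕ} (h : ∀ i, a ≤ i → i < a + m → f i = g i) :
    orderedProd f a m = orderedProd g a m := by
  refine congrArg List.prod (List.map_congr_left fun i hi => ?_)
  obtain ⟨ha, hm⟩ := List.mem_range'_1.mp hi
  exact h i ha hm

theorem orderedProd_induction {p : M → Prop} {f : ℕ → M} {a m : ℕ} (one : p 1)
    (mul : ∀ x y, p x → p y → p (x * y)) (h : ∀ i, a ≤ i → i < a + m → p (f i)) :
    p (orderedProd f a m) := by
  refine List.prod_induction p mul one fun y hy => ?_
  obtain ⟨i, hi, rfl⟩ := List.mem_map.mp hy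
  obtain ⟨ha, hm⟩ := List.mem_range'_1.mp hi
  exact h i ha hm

theorem commute_orderedProd {f : ℕ → M} {x : M} {a m : ℕ}
    (h : ∀ i, a ≤ i → i < a + m → Commute x (f i)) : Commute x (orderedProd f a m) :=
  orderedProd_induction (Commute.one_right x) (fun _ _ => Commute.mul_right) h

theorem op_orderedProd (f : ℕ → M) {a a' m n : ℕ} (h : a + m + a' = n) :
    MulOpposite.op (orderedProd f a m) =
      orderedProd (fun i => MulOpposite.op (f (n - 1 - i))) a' m := by
  induction m generalizing a with
  | zero => rfl
  | succ m ih =>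
    rw [orderedProd_succ_left, orderedProd_succ, MulOpposite.op_mul, ih (by omega),
      show n - 1 - (a' + m) = a by omega]

/-- Carrying `W` through the product step by step, leaving behind the factors `y`. -/
theorem orderedProd_intertwine {A B W y : ℕ → M} {a m : ℕ}
    (h : ∀ r, a ≤ r → r < a + m → B r * W (r + 1) = W r * A r * y r)
    (hy : ∀ r r', a ≤ r → r < r' → r' < a + m → Commute (y r) (A r')) :
    orderedProd B a m * W (a + m) = W a * orderedProd A a m * orderedProd y a m := by
  induction m with
  | zero => simp only [orderedProd_zero, one_mul, mul_one, add_zero]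
  | succ m ih =>
    have hcomm : Commute (A (a + m)) (orderedProd y a m) :=
      commute_orderedProd fun r ha hr => (hy r _ ha hr (by omega)).symm
    calc orderedProd B a (m + 1) * W (a + (m + 1))
        = orderedProd B a m * (B (a + m) * W (a + m + 1)) := by
          rw [orderedProd_succ, mul_assoc, add_assoc]
      _ = orderedProd B a m * W (a + m) * A (a + m) * y (a + m) := by
          rw [h _ (by omega) (by omega)]; simp only [mul_assoc]
      _ = W a * orderedProd A a m * (orderedProd y a m * A (a + m)) * y (a + m) := by
          rw [ih (fun r ha hr => h r ha (by omega)) fun r r' ha hr hr' => hy r r' ha hr (by omega)]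
          simp only [mul_assoc]
      _ = W a * orderedProd A a (m + 1) * orderedProd y a (m + 1) := by
          rw [← hcomm.eq, orderedProd_succ, orderedProd_succ]; simp only [mul_assoc]

theorem orderedProd_mul {f g : ℕ → M} {a m : ℕ}
    (h : ∀ r r', a ≤ r → r < r' → r' < a + m → Commute (g r) (f r')) :
    orderedProd (fun i => f i * g i) a m = orderedProd f a m * orderedProd g a m := by
  simpa only [one_mul, mul_one] using
    orderedProd_intertwine (W := fun _ => 1) (fun _ _ _ => by rw [mul_one, one_mul]) h

theorem mul_orderedProd_mul_orderedProd {A w : ℕ → M} {y : M} {a m : ℕ}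
    (hf : ∀ i, a ≤ i → i < a + m → y * A i * w i = w i * A i * y)
    (hw : ∀ i i', a ≤ i → i < a + m → a ≤ i' → i' < a + m → i ≠ i' → Commute (w i) (A i')) :
    y * orderedProd A a m * orderedProd w a m = orderedProd w a m * orderedProd A a m * y := by
  rw [← orderedProd_mul (f := w) fun i i' hi hii' hi' =>
    (hw i' i (by omega) hi' hi (by omega) (by omega)).symm]
  exact (orderedProd_intertwine (W := fun _ => y) (fun i hi hi' => (hf i hi hi').symm)
    fun i i' hi hii' hi' => hw i i' hi (by omega) (by omega) hi' (by omega)).symm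

theorem orderedProd_update_mul {n p : ℕ} (hp : p < n) (A w : ℕ → M) (y : M)
    (hf : ∀ i, p < i → i < n → y * A i * w i = w i * A i * y)
    (hw : ∀ i i', i < n → i' < n → i ≠ i' → Commute (w i) (A i')) :
    orderedProd (Function.update A p (w p * A p * y)) 0 n * orderedProd w (p + 1) (n - (p + 1)) =
      orderedProd w p (n - p) * orderedProd A 0 n * y := by
  obtain ⟨m, rfl⟩ := Nat.exists_eq_add_of_lt hp
  have hsplit (f : ℕ → M) : orderedProd f 0 (p + m + 1) =
      orderedProd f 0 p * (f p * orderedProd f (p + 1) m) := by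
    rw [add_assoc, orderedProd_add, orderedProd_succ_left, zero_add]
  have hleft : orderedProd (Function.update A p (w p * A p * y)) 0 p = orderedProd A 0 p :=
    orderedProd_congr fun i _ hi => Function.update_of_ne (by omega) _ _
  have hright : orderedProd (Function.update A p (w p * A p * y)) (p + 1) m =
      orderedProd A (p + 1) m :=
    orderedProd_congr fun i hi _ => Function.update_of_ne (by omega) _ _
  have hflip : y * orderedProd A (p + 1) m * orderedProd w (p + 1) m =
      orderedProd w (p + 1) m * orderedProd A (p + 1) m * y :=
    mul_orderedProd_mul_orderedProd (fun i hi hi' => hf i (by omega) (by omega))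
      fun i i' _ hi _ hi' => hw i i' (by omega) (by omega)
  have hcommP : Commute (w p * orderedProd w (p + 1) m) (orderedProd A 0 p) := by
    rw [← orderedProd_succ_left]
    exact commute_orderedProd fun i _ hi =>
      (commute_orderedProd fun j hj hj' => (hw j i (by omega) (by omega) (by omega)).symm).symm
  have hcommA : Commute (A p) (orderedProd w (p + 1) m) :=
    commute_orderedProd fun j hj hj' => (hw j p (by omega) (by omega) (by omega)).symm
  rw [show p + m + 1 - (p + 1) = m by omega, show p + m + 1 - p = m + 1 by omega, hsplit, hsplit,
    hleft, hright, Function.update_self, orderedProd_succ_left]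
  generalize orderedProd A 0 p = P at *
  generalize orderedProd A (p + 1) m = Q at *
  generalize orderedProd w (p + 1) m = V at *
  calc P * (w p * A p * y * Q) * V
      = P * w p * A p * (y * Q * V) := by simp only [mul_assoc]
    _ = P * w p * (A p * V) * Q * y := by rw [hflip]; simp only [mul_assoc]
    _ = (P * (w p * V)) * A p * Q * y := by rw [hcommA.eq]; simp only [mul_assoc]
    _ = w p * V * (P * (A p * Q)) * y := by rw [← hcommP.eq]; simp only [mul_assoc]

/-- The product of the elements of an `n × n` array, row after row. -/
def gridProd (n : ℕ) (A : ℕ → ℕ → M) : M :=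
  orderedProd (fun r => orderedProd (fun i => A i r) 0 n) 0 n

theorem gridProd_congr {n : ℕ} {A B : ℕ → ℕ → M} (h : ∀ i r, i < n → r < n → A i r = B i r) :
    gridProd n A = gridProd n B :=
  orderedProd_congr fun r _ hr => orderedProd_congr fun i _ hi => h i r (by omega) (by omega)

theorem op_gridProd (n : ℕ) (A : ℕ → ℕ → M) :
    MulOpposite.op (gridProd n A) =
      gridProd n (fun i r => MulOpposite.op (A (n - 1 - i) (n - 1 - r))) := by
  simp only [gridProd, op_orderedProd _ (show 0 + n + 0 = n by omega)]

/-- A line crossing the array along `i = r + e` can be moved to the upper right of the array: `w i`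
and `y r` are its crossings with the column `i` and with the row `r`. -/
theorem gridProd_push_upper {n e : ℕ} (he : e ≤ n) (A : ℕ → ℕ → M) (w y : ℕ → M)
    (hf : ∀ i r, i < n → r < n → r + e < i → y r * A i r * w i = w i * A i r * y r)
    (hw : ∀ i i' r, i < n → i' < n → r < n → i ≠ i' → Commute (w i) (A i' r))
    (hy : ∀ i r r', i < n → r < n → r' < n → r ≠ r' → Commute (y r) (A i r')) :
    gridProd n (fun i r => if i = r + e then w i * A i r * y r else A i r) =
      orderedProd w e (n - e) * gridProd n A * orderedProd y 0 (n - e) := by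
  set rowA : ℕ → M := fun r => orderedProd (fun i => A i r) 0 n
  set rowB : ℕ → M := fun r =>
    orderedProd (fun i => if i = r + e then w i * A i r * y r else A i r) 0 n
  have hcross (r : ℕ) (hr : r < 0 + (n - e)) :
      rowB r * orderedProd w (r + 1 + e) (n - (r + 1 + e)) =
        orderedProd w (r + e) (n - (r + e)) * rowA r * y r := by
    have hrow := orderedProd_update_mul (n := n) (p := r + e) (by omega) (fun i => A i r) w (y r)
      (fun i hi hin => hf i r hin (by omega) hi) fun i i' hi hi' => hw i i' r hi hi' (by omega)
    rw [Nat.add_right_comm r 1 e, ← hrow]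
    refine congrArg (· * _) (orderedProd_congr fun i _ _ => ?_)
    rcases eq_or_ne i (r + e) with rfl | hi
    · simp only [if_true, Function.update_self]
    · simp only [if_neg hi, Function.update_of_ne hi]
  have hcomm (r : ℕ) (hr : r < n - e) (r' : ℕ) (hr' : r' < n) (hne : r ≠ r') :
      Commute (y r) (rowA r') :=
    commute_orderedProd fun i _ hi => hy i r r' (by omega) (by omega) hr' hne
  have hmoved : orderedProd rowB 0 (n - e) =
      orderedProd w e (n - e) * orderedProd rowA 0 (n - e) * orderedProd y 0 (n - e) := by
    simpa [he] using orderedProd_intertwine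
      (W := fun r => orderedProd w (r + e) (n - (r + e))) (a := 0) (m := n - e)
      (fun r _ hr => hcross r hr) fun r r' _ hrr' hr' => hcomm r (by omega) r' (by omega) hrr'.ne
  have hrest : orderedProd rowB (n - e) e = orderedProd rowA (n - e) e :=
    orderedProd_congr fun r hr _ => orderedProd_congr fun i _ hi => if_neg (by omega)
  have hpast : Commute (orderedProd y 0 (n - e)) (orderedProd rowA (n - e) e) :=
    commute_orderedProd fun r' hr hr' => (commute_orderedProd fun r _ hr =>
      (hcomm r (by omega) r' (by omega) (by omega)).symm).symm
  have hsplit (f : ℕ → M) : orderedProd f 0 n =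
      orderedProd f 0 (n - e) * orderedProd f (n - e) e := by
    conv_lhs => rw [← Nat.sub_add_cancel he, orderedProd_add, zero_add]
  change orderedProd rowB 0 n = _ * orderedProd rowA 0 n * _
  rw [hsplit, hsplit rowA, hmoved, hrest, mul_assoc, hpast.eq]
  simp only [mul_assoc]

theorem gridProd_push_lower {n e : ℕ} (he : e ≤ n) (A : ℕ → ℕ → M) (w y : ℕ → M)
    (hf : ∀ i r, i < n → r < n → i + e < r → w i * A i r * y r = y r * A i r * w i)
    (hw : ∀ i i' r, i < n → i' < n → r < n → i ≠ i' → Commute (w i) (A i' r))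
    (hy : ∀ i r r', i < n → r < n → r' < n → r ≠ r' → Commute (y r) (A i r')) :
    gridProd n (fun i r => if r = i + e then y r * A i r * w i else A i r) =
      orderedProd y e (n - e) * gridProd n A * orderedProd w 0 (n - e) := by
  -- Reversing the order of all products turns the lower left corner into the upper right one.
  refine MulOpposite.op_injective ?_
  have hupper := gridProd_push_upper he (fun i r => MulOpposite.op (A (n - 1 - i) (n - 1 - r)))
    (fun i => MulOpposite.op (w (n - 1 - i))) (fun r => MulOpposite.op (y (n - 1 - r)))
    (fun i r hi hr hri => by
      simpa only [MulOpposite.op_mul, mul_assoc] using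
        congrArg MulOpposite.op (hf (n - 1 - i) (n - 1 - r) (by omega) (by omega) (by omega)))
    (fun i i' r hi hi' hr hne => (hw _ _ _ (by omega) (by omega) (by omega) (by omega)).op)
    (fun i r r' hi hr hr' hne => (hy _ _ _ (by omega) (by omega) (by omega) (by omega)).op)
  rw [MulOpposite.op_mul, MulOpposite.op_mul, op_gridProd, op_gridProd,
    op_orderedProd w (show 0 + (n - e) + e = n by omega),
    op_orderedProd y (show e + (n - e) + 0 = n by omega), ← mul_assoc, ← hupper]
  refine gridProd_congr fun i r hi hr => ?_
  by_cases h : i = r + e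
  · rw [if_pos h, if_pos (by omega), MulOpposite.op_mul, MulOpposite.op_mul, mul_assoc]
  · rw [if_neg h, if_neg (by omega)]

end OrderedProducts

section LineOperators

/-- The horizontal lines (numbered from the top), the vertical lines (from the left), and the
diagonal lines (by the column minus the row from the top). -/
inductive Line
  | horiz (r : ℕ)
  | vert (i : ℕ)
  | diag (e : ℤ)
  deriving DecidableEq

/-- Occupation of all lines along a cut of the lattice. -/
abbrev LineState : Type := Line → Bool

variable (R : Type*) [CommSemiring R]

/-- Vertex operators act on functions of the line states. -/
abbrev LineOp : Type _ := Module.End R (LineState → R)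

/-- Weights of the crossing of two lines, as functions of the occupation of the two lines before
and then after the crossing. -/
abbrev PairWeight : Type _ := Bool → Bool → Bool → Bool → R

/-- Weights of the crossing of three lines, as functions of the occupation of the three lines before
and then after the crossing. -/
abbrev NodeWeight : Type _ := Bool → Bool → Bool → Bool → Bool → Bool → R

variable {R}

/-- The vertex operator of the crossing of the lines `a` and `b`, with weights `m`. -/
def pairOp (m : PairWeight R) (a b : Line) : LineOp R where
  toFun f x := ∑ p, ∑ q, m (x a) (x b) p q * f (Function.update (Function.update x a p) b q)
  map_add' f g := by
    funext x
    simp only [Pi.add_apply, mul_add, Finset.sum_add_distrib]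
  map_smul' k f := by
    funext x
    simp only [Pi.smul_apply, smul_eq_mul, Finset.mul_sum, RingHom.id_apply, mul_left_comm k]

/-- The vertex operator of the crossing of the lines `a`, `b` and `c`, with weights `M`. -/
def nodeOp (M : NodeWeight R) (a b c : Line) : LineOp R where
  toFun f x := ∑ o : Bool × Bool × Bool, M (x a) (x b) (x c) o.1 o.2.1 o.2.2 *
    f (Function.update (Function.update (Function.update x a o.1) b o.2.1) c o.2.2)
  map_add' f g := by
    funext x
    simp only [Pi.add_apply, mul_add, Finset.sum_add_distrib]
  map_smul' k f := by
    funext x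
    simp only [Pi.smul_apply, smul_eq_mul, Finset.mul_sum, RingHom.id_apply, mul_left_comm k]

theorem pairOp_apply (m : PairWeight R) (a b : Line) (f : LineState → R) (x : LineState) :
    pairOp m a b f x =
      ∑ p, ∑ q, m (x a) (x b) p q * f (Function.update (Function.update x a p) b q) := rfl

theorem nodeOp_apply (M : NodeWeight R) (a b c : Line) (f : LineState → R) (x : LineState) :
    nodeOp M a b c f x =
      ∑ o : Bool × Bool × Bool, M (x a) (x b) (x c) o.1 o.2.1 o.2.2 *
        f (Function.update (Function.update (Function.update x a o.1) b o.2.1) c o.2.2) := rfl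

theorem commute_pairOp (m m' : PairWeight R) {a b c d : Line}
    (hac : a ≠ c) (had : a ≠ d) (hbc : b ≠ c) (hbd : b ≠ d) :
    Commute (pairOp m a b) (pairOp m' c d) := by
  refine LinearMap.ext fun f => funext fun x => ?_
  have hupdate (p q p' q' : Bool) :
      Function.update (Function.update (Function.update (Function.update x c p') d q') a p) b q =
        Function.update (Function.update (Function.update (Function.update x a p) b q) c p')
          d q' := by
    rw [Function.update_comm had.symm, Function.update_comm hac.symm,
      Function.update_comm hbd.symm, Function.update_comm hbc.symm]
  simp only [Module.End.mul_apply, pairOp_apply, Fintype.sum_bool, Function.update_of_ne hac,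
    Function.update_of_ne had, Function.update_of_ne hbc, Function.update_of_ne hbd,
    Function.update_of_ne hac.symm, Function.update_of_ne had.symm,
    Function.update_of_ne hbc.symm, Function.update_of_ne hbd.symm, hupdate]
  ring

theorem pairOp_eq_nodeOp (m : PairWeight R) {a b c : Line} (hac : a ≠ c) (hbc : b ≠ c) :
    pairOp m a b = nodeOp (fun h v d p q u => if u = d then m h v p q else 0) a b c := by
  refine LinearMap.ext fun f => funext fun x => ?_
  have hupdate (p q : Bool) :
      Function.update (Function.update (Function.update x a p) b q) c (x c) =
        Function.update (Function.update x a p) b q := by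
    rw [Function.update_eq_self_iff, Function.update_of_ne hbc.symm, Function.update_of_ne hac.symm]
  simp only [pairOp_apply, nodeOp_apply, Fintype.sum_prod_type]
  refine Finset.sum_congr rfl fun p _ => Finset.sum_congr rfl fun q _ => ?_
  rw [Fintype.sum_eq_single (x c)]
  · simp only [if_true, hupdate]
  · intro u hu
    simp only [if_neg hu, zero_mul]

/-- The weights of the triangle where the diagonal passes to the upper right of the crossing of the
two other lines. -/
def triangleUpper (mX mY mW : PairWeight R) : NodeWeight R := fun h v d p q u =>
  ∑ d', ∑ v', ∑ h', mW d v d' v' * mX h v' h' q * mY h' d' p u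

/-- The weights of the triangle where the diagonal passes to the lower left of the crossing of the
two other lines. -/
def triangleLower (mX mY mW : PairWeight R) : NodeWeight R := fun h v d p q u =>
  ∑ h', ∑ d', ∑ v', mY h d h' d' * mX h' v p v' * mW d' v' u q

theorem triangleUpper_smul (mX mY mW : PairWeight R) (y w : R) :
    triangleUpper mX (y • mY) (w • mW) = (y * w) • triangleUpper mX mY mW := by
  funext h v d p q u
  simp only [triangleUpper, Pi.smul_apply, smul_eq_mul, Finset.mul_sum]
  exact Finset.sum_congr rfl fun _ _ => Finset.sum_congr rfl fun _ _ =>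
    Finset.sum_congr rfl fun _ _ => by ring

theorem triangleLower_smul (mX mY mW : PairWeight R) (y w : R) :
    triangleLower mX (y • mY) (w • mW) = (y * w) • triangleLower mX mY mW := by
  funext h v d p q u
  simp only [triangleLower, Pi.smul_apply, smul_eq_mul, Finset.mul_sum]
  exact Finset.sum_congr rfl fun _ _ => Finset.sum_congr rfl fun _ _ =>
    Finset.sum_congr rfl fun _ _ => by ring

theorem pairOp_mul_eq_triangleUpper (mX mY mW : PairWeight R) {a b c : Line} (hab : a ≠ b)
    (hac : a ≠ c) (hbc : b ≠ c) :
    pairOp mW c b * pairOp mX a b * pairOp mY a c = nodeOp (triangleUpper mX mY mW) a b c := by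
  refine LinearMap.ext fun f => funext fun x => ?_
  have hupdate (d' v' h' q p u : Bool) :
      Function.update (Function.update (Function.update (Function.update
        (Function.update (Function.update x c d') b v') a h') b q) a p) c u =
      Function.update (Function.update (Function.update x a p) b q) c u := by
    grind [Function.update_apply]
  simp only [Module.End.mul_apply, pairOp_apply, nodeOp_apply, triangleUpper, hupdate,
    Function.update_self, Function.update_of_ne hab, Function.update_of_ne hac,
    Function.update_of_ne hac.symm, Function.update_of_ne hbc.symm, Fintype.sum_prod_type,
    Fintype.sum_bool]
  ring

theorem pairOp_mul_eq_triangleLower (mX mY mW : PairWeight R) {a b c : Line} (hab : a ≠ b)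
    (hac : a ≠ c) (hbc : b ≠ c) :
    pairOp mY a c * pairOp mX a b * pairOp mW c b = nodeOp (triangleLower mX mY mW) a b c := by
  refine LinearMap.ext fun f => funext fun x => ?_
  have hupdate (h' d' p v' u q : Bool) :
      Function.update (Function.update (Function.update (Function.update
        (Function.update (Function.update x a h') c d') a p) b v') c u) b q =
      Function.update (Function.update (Function.update x a p) b q) c u := by
    grind [Function.update_apply]
  simp only [Module.End.mul_apply, pairOp_apply, nodeOp_apply, triangleLower, hupdate,
    Function.update_self, Function.update_of_ne hac, Function.update_of_ne hbc,
    Function.update_of_ne hab.symm, Function.update_of_ne hac.symm, Function.update_of_ne hbc.symm,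
    Fintype.sum_prod_type, Fintype.sum_bool]
  ring

/-- Six-vertex weights: `a` for no or two paths, `b` for a path that goes straight, `c` for a path
that turns from the first line to the second one, `c'` for a path that turns from the second line
to the first one. -/
def sixWeight (a b c c' : R) : PairWeight R
  | false, false, false, false => a
  | true, true, true, true => a
  | true, false, true, false => b
  | false, true, false, true => b
  | true, false, false, true => c
  | false, true, true, false => c'
  | _, _, _, _ => 0

theorem triangleUpper_sixWeight_eq_triangleLower {R : Type*} [CommRing R]
    {a₁ b₁ c c' a₂ b₂ a₃ b₃ : R}
    (ha : c * a₁ + b₂ * b₃ = a₂ * a₃) (hc : a₁ * b₂ + c' * b₃ = b₁ * a₂)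
    (hb : a₁ * b₃ + c * b₂ = b₁ * a₃) :
    triangleUpper (sixWeight a₁ b₁ c c') (sixWeight a₂ b₂ c c') (sixWeight a₃ b₃ c c) =
      triangleLower (sixWeight a₁ b₁ c c') (sixWeight a₂ b₂ c c') (sixWeight a₃ b₃ c c) := by
  funext h v d p q u
  simp only [triangleUpper, triangleLower, Fintype.sum_bool]
  cases h <;> cases v <;> cases d <;> cases p <;> cases q <;> cases u <;>
    simp only [sixWeight, mul_zero, zero_mul, add_zero, zero_add] <;> grind only

end LineOperators

section RemovingDiagonals

variable {R : Type*} [CommSemiring R]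

/-- Vertex weights for which crossings of two empty or of two occupied lines are trivial. -/
def IsFrozen (m : PairWeight R) : Prop :=
  ∀ s p q, m s s p q = (if p = s ∧ q = s then 1 else 0) ∧
    m p q s s = (if p = s ∧ q = s then 1 else 0)

theorem IsFrozen.pairOp_apply {m : PairWeight R} (hm : IsFrozen m) {a b : Line} {x : LineState}
    (hab : x a = x b) (f : LineState → R) : pairOp m a b f x = f x := by
  have hx (p q : Bool) : m (x a) (x b) p q = if p = x a ∧ q = x b then 1 else 0 := by
    rw [← hab, (hm (x a) p q).1]
  rw [TwentyV.pairOp_apply, Fintype.sum_eq_single (x a), Fintype.sum_eq_single (x b)]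
  · simp [hx]
  · intro q hq
    simp [hx, hq]
  · intro p hp
    simp [hx, hp]

theorem IsFrozen.pairOp_indicator {m : PairWeight R} (hm : IsFrozen m) {a b : Line} (hne : a ≠ b)
    {y : LineState} (hab : y a = y b) :
    pairOp m a b (Set.indicator {y} 1) = Set.indicator {y} 1 := by
  have hvanish (x : LineState) (l : Line) (hl : x l ≠ y l) :
      Set.indicator {y} (1 : LineState → R) x = 0 :=
    Set.indicator_of_notMem (s := {y}) (fun h => hl (congrFun h l)) _
  funext x
  rw [TwentyV.pairOp_apply, Fintype.sum_eq_single (y a), Fintype.sum_eq_single (y b), ← hab,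
    (hm (y a) _ _).2]
  · by_cases h : x a = y a ∧ x b = y a
    · rw [if_pos h, one_mul, ← h.1, Function.update_eq_self, h.1, ← h.2, Function.update_eq_self]
    · rw [if_neg h, zero_mul]
      by_cases ha : x a = y a
      · exact (hvanish x b fun hb => h ⟨ha, hb.trans hab.symm⟩).symm
      · exact (hvanish x a ha).symm
  · intro q hq
    rw [hvanish _ b (by simpa using hq), mul_zero]
  · intro p hp
    exact Finset.sum_eq_zero fun q _ => by rw [hvanish _ a (by simpa [hne] using hp), mul_zero]

/-- The operator of the crossing of column `i` and row `r`. -/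
def crossOp (mX : ℕ → PairWeight R) (i r : ℕ) : LineOp R :=
  pairOp (mX r) (.horiz r) (.vert i)

/-- The operator of the crossing of row `r` and the diagonal `e`. -/
def horizDiagOp (mY : ℕ → PairWeight R) (e : ℤ) (r : ℕ) : LineOp R :=
  pairOp (mY r) (.horiz r) (.diag e)

/-- The operator of the crossing of the diagonal `e` and column `i`. -/
def diagVertOp (mW : PairWeight R) (e : ℤ) (i : ℕ) : LineOp R :=
  pairOp mW (.diag e) (.vert i)

/-- The operator of the triple crossing in column `i` and row `r`. -/
def tripleOp (mX mY : ℕ → PairWeight R) (mW : PairWeight R) (i r : ℕ) : LineOp R :=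
  diagVertOp mW (i - r) i * crossOp mX i r * horizDiagOp mY (i - r) r

/-- The operator of the node in column `i` and row `r` when only the diagonals `e` with `a ≤ e < b`
run through the square. -/
def partialOp (mX mY : ℕ → PairWeight R) (mW : PairWeight R) (a b : ℤ) (i r : ℕ) : LineOp R :=
  if a ≤ (i : ℤ) - r ∧ (i : ℤ) - r < b then tripleOp mX mY mW i r else crossOp mX i r

/-- The line state on the upper left of the square for the domain wall boundary condition. -/
def inState (n : ℕ) : LineState
  | .horiz r => decide (r < n)
  | .vert _ => false
  | .diag e => decide (-(n : ℤ) < e ∧ e < 0)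

/-- The line state on the lower right of the square for the domain wall boundary condition. -/
def outState (n : ℕ) : LineState
  | .horiz _ => false
  | .vert i => decide (i < n)
  | .diag e => decide (-(n : ℤ) < e ∧ e < 0)

/-- The matrix element of a line operator between the two line states of the domain wall boundary
condition. -/
noncomputable def wallElement (n : ℕ) (P : LineOp R) : R :=
  P (Set.indicator {outState n} 1) (inState n)

theorem wallElement_mul_mul {n : ℕ} {V U : LineOp R} (P : LineOp R)
    (hV : ∀ f, V f (inState n) = f (inState n))
    (hU : U (Set.indicator {outState n} 1) = Set.indicator {outState n} 1) :
    wallElement n (V * P * U) = wallElement n P := by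
  simp only [wallElement, Module.End.mul_apply, hV, hU]

theorem orderedProd_apply_of_fixed {f : ℕ → LineOp R} {a m : ℕ} {g : LineState → R}
    (h : ∀ i, a ≤ i → i < a + m → f i g = g) : orderedProd f a m g = g :=
  orderedProd_induction (p := fun P : LineOp R => P g = g) rfl
    (fun P Q hP hQ => by rw [Module.End.mul_apply, hQ, hP]) h

theorem orderedProd_apply_apply_of_fixed {f : ℕ → LineOp R} {a m : ℕ} {x : LineState}
    (h : ∀ i, a ≤ i → i < a + m → ∀ g, f i g x = g x) (g : LineState → R) :
    orderedProd f a m g x = g x :=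
  orderedProd_induction (p := fun P : LineOp R => ∀ g, P g x = g x) (fun _ => rfl)
    (fun P Q hP hQ g => by rw [Module.End.mul_apply, hP, hQ]) h g

variable {mX mY : ℕ → PairWeight R} {mW : PairWeight R}

theorem tripleOp_eq_nodeOp (i r : ℕ) : tripleOp mX mY mW i r =
    nodeOp (triangleUpper (mX r) (mY r) mW) (.horiz r) (.vert i) (.diag (i - r)) :=
  pairOp_mul_eq_triangleUpper _ _ _ (by simp) (by simp) (by simp)

theorem horizDiagOp_mul_crossOp_mul_diagVertOp {r : ℕ}
    (hYB : triangleUpper (mX r) (mY r) mW = triangleLower (mX r) (mY r) mW) (e : ℤ) (i : ℕ) :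
    horizDiagOp mY e r * crossOp mX i r * diagVertOp mW e i =
      diagVertOp mW e i * crossOp mX i r * horizDiagOp mY e r := by
  unfold horizDiagOp crossOp diagVertOp
  rw [pairOp_mul_eq_triangleLower _ _ _ (by simp) (by simp) (by simp),
    pairOp_mul_eq_triangleUpper _ _ _ (by simp) (by simp) (by simp), hYB]

theorem commute_diagVertOp_partialOp {a b e : ℤ} (he : e < a ∨ b ≤ e) {i i' : ℕ} (h : i ≠ i')
    (r : ℕ) : Commute (diagVertOp mW e i) (partialOp mX mY mW a b i' r) := by
  have hcross : Commute (diagVertOp mW e i) (crossOp mX i' r) :=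
    commute_pairOp _ _ (by simp) (by simp) (by simp) (by simpa using h)
  unfold partialOp
  split_ifs with hab
  · have hne : e ≠ (i' : ℤ) - r := by omega
    refine Commute.mul_right (Commute.mul_right ?_ hcross) ?_
    · exact commute_pairOp _ _ (by simpa using hne) (by simp) (by simp) (by simpa using h)
    · exact commute_pairOp _ _ (by simp) (by simpa using hne) (by simp) (by simp)
  · exact hcross

theorem commute_horizDiagOp_partialOp {a b e : ℤ} (he : e < a ∨ b ≤ e) {r r' : ℕ} (h : r ≠ r')
    (i : ℕ) : Commute (horizDiagOp mY e r) (partialOp mX mY mW a b i r') := by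
  have hcross : Commute (horizDiagOp mY e r) (crossOp mX i r') :=
    commute_pairOp _ _ (by simpa using h) (by simp) (by simp) (by simp)
  unfold partialOp
  split_ifs with hab
  · have hne : e ≠ (i : ℤ) - r' := by omega
    refine Commute.mul_right (Commute.mul_right ?_ hcross) ?_
    · exact commute_pairOp _ _ (by simp) (by simp) (by simpa using hne) (by simp)
    · exact commute_pairOp _ _ (by simpa using h) (by simp) (by simp) (by simpa using hne)
  · exact hcross

/-- The diagonal `e ≥ 0` is moved to the upper right corner, where it is empty like the lines that
it meets. -/
theorem wallElement_partialOp_upper {n : ℕ}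
    (hYB : ∀ r, triangleUpper (mX r) (mY r) mW = triangleLower (mX r) (mY r) mW)
    (hY : ∀ r, IsFrozen (mY r)) (hW : IsFrozen mW) {a : ℤ} {e : ℕ} (ha : a ≤ e) (he : e ≤ n) :
    wallElement n (gridProd n (partialOp mX mY mW a (e + 1))) =
      wallElement n (gridProd n (partialOp mX mY mW a e)) := by
  have hinsert : gridProd n (partialOp mX mY mW a (e + 1)) =
      gridProd n (fun i r => if i = r + e then
        diagVertOp mW e i * partialOp mX mY mW a e i r * horizDiagOp mY e r
        else partialOp mX mY mW a e i r) := by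
    refine gridProd_congr fun i r _ _ => ?_
    by_cases h : i = r + e
    · rw [if_pos h, partialOp, partialOp, if_pos (by omega), if_neg (by omega), tripleOp,
        show (i : ℤ) - r = e by omega]
    · rw [if_neg h]
      exact if_congr (by omega) rfl rfl
  rw [hinsert, gridProd_push_upper he, wallElement_mul_mul]
  · refine orderedProd_apply_apply_of_fixed fun i _ _ => hW.pairOp_apply ?_
    simp [inState]
  · refine orderedProd_apply_of_fixed fun r _ _ => (hY r).pairOp_indicator (by simp) ?_
    simp [outState]
  · intro i r _ _ hi
    rw [partialOp, if_neg (by omega), horizDiagOp_mul_crossOp_mul_diagVertOp (hYB r)]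
  · exact fun i i' r _ _ _ h => commute_diagVertOp_partialOp (Or.inr le_rfl) h r
  · exact fun i r r' _ _ _ h => commute_horizDiagOp_partialOp (Or.inr le_rfl) h i

/-- The diagonal `-e < 0` is moved to the lower left corner, where it is occupied like the lines
that it meets. -/
theorem wallElement_partialOp_lower {n : ℕ}
    (hYB : ∀ r, triangleUpper (mX r) (mY r) mW = triangleLower (mX r) (mY r) mW)
    (hY : ∀ r, IsFrozen (mY r)) (hW : IsFrozen mW) {b : ℤ} {e : ℕ} (hpos : 0 < e) (he : e ≤ n)
    (hb : -(e : ℤ) < b) :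
    wallElement n (gridProd n (partialOp mX mY mW (-e) b)) =
      wallElement n (gridProd n (partialOp mX mY mW (-e + 1) b)) := by
  have hinsert : gridProd n (partialOp mX mY mW (-e) b) =
      gridProd n (fun i r => if r = i + e then
        horizDiagOp mY (-e) r * partialOp mX mY mW (-e + 1) b i r * diagVertOp mW (-e) i
        else partialOp mX mY mW (-e + 1) b i r) := by
    refine gridProd_congr fun i r _ _ => ?_
    by_cases h : r = i + e
    · rw [if_pos h, partialOp, partialOp, if_pos (by omega), if_neg (by omega), tripleOp,
        horizDiagOp_mul_crossOp_mul_diagVertOp (hYB r), show (i : ℤ) - r = -e by omega]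
    · rw [if_neg h]
      exact if_congr (by omega) rfl rfl
  rw [hinsert, gridProd_push_lower he, wallElement_mul_mul]
  · refine orderedProd_apply_apply_of_fixed fun r _ hr => (hY r).pairOp_apply ?_
    simp only [inState, decide_eq_decide]
    omega
  · refine orderedProd_apply_of_fixed fun i _ hi => hW.pairOp_indicator (by simp) ?_
    simp only [outState, decide_eq_decide]
    omega
  · intro i r _ _ hi
    rw [partialOp, if_neg (by omega), horizDiagOp_mul_crossOp_mul_diagVertOp (hYB r)]
  · exact fun i i' r _ _ _ h => commute_diagVertOp_partialOp (Or.inl (by omega)) h r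
  · exact fun i r r' _ _ _ h => commute_horizDiagOp_partialOp (Or.inl (by omega)) h i

theorem wallElement_gridProd_tripleOp (n : ℕ)
    (hYB : ∀ r, triangleUpper (mX r) (mY r) mW = triangleLower (mX r) (mY r) mW)
    (hY : ∀ r, IsFrozen (mY r)) (hW : IsFrozen mW) :
    wallElement n (gridProd n (tripleOp mX mY mW)) =
      wallElement n (gridProd n (crossOp mX)) := by
  have hupper (e : ℕ) (he : e ≤ n) : wallElement n (gridProd n (partialOp mX mY mW (-n) e)) =
      wallElement n (gridProd n (partialOp mX mY mW (-n) 0)) := by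
    induction e with
    | zero => rfl
    | succ e ih =>
      rw [← ih (by omega), Nat.cast_succ,
        wallElement_partialOp_upper hYB hY hW (by omega) (by omega)]
  have hlower (e : ℕ) (he : e ≤ n) : wallElement n (gridProd n (partialOp mX mY mW (-e) 0)) =
      wallElement n (gridProd n (partialOp mX mY mW 0 0)) := by
    induction e with
    | zero => rfl
    | succ e ih =>
      rw [← ih (by omega), wallElement_partialOp_lower hYB hY hW (by omega) he (by omega),
        Nat.cast_succ, neg_add, neg_add_cancel_right]
  calc wallElement n (gridProd n (tripleOp mX mY mW))
      = wallElement n (gridProd n (partialOp mX mY mW (-n) n)) :=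
        congrArg _ (gridProd_congr fun i r hi hr => (if_pos (by omega)).symm)
    _ = wallElement n (gridProd n (partialOp mX mY mW 0 0)) := by
        rw [hupper n le_rfl, hlower n le_rfl]
    _ = wallElement n (gridProd n (crossOp mX)) :=
        congrArg _ (gridProd_congr fun _ _ _ _ => if_neg (by omega))

end RemovingDiagonals

section Expansion

variable {R X O : Type*} [CommSemiring R]

/-- The state reached from `x` after a number of steps with the choices `o`. -/
def runSteps (step : ℕ → X → O → X) (x : X) (o : ℕ → O) : ℕ → X
  | 0 => x
  | k + 1 => step k (runSteps step x o k) (o k)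

theorem runSteps_congr (step : ℕ → X → O → X) (x : X) {o o' : ℕ → O} {m : ℕ}
    (h : ∀ k, k < m → o k = o' k) : runSteps step x o m = runSteps step x o' m := by
  induction m with
  | zero => rfl
  | succ m ih =>
    rw [runSteps, runSteps, ih fun k hk => h k (by omega), h m (by omega)]

/-- Extension of a finite sequence by a default value. -/
def extendSeq [Inhabited O] {m : ℕ} (o : Fin m → O) (k : ℕ) : O :=
  if h : k < m then o ⟨k, h⟩ else default

theorem extendSeq_val [Inhabited O] {m : ℕ} (o : Fin m → O) (k : Fin m) :
    extendSeq o k = o k :=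
  dif_pos k.isLt

theorem runSteps_extendSeq_snoc [Inhabited O] (step : ℕ → X → O → X) (x : X) {m : ℕ}
    (o : Fin m → O) (a : O) {k : ℕ} (hk : k ≤ m) :
    runSteps step x (extendSeq (Fin.snoc o a : Fin (m + 1) → O)) k =
      runSteps step x (extendSeq o) k := by
  refine runSteps_congr step x fun i hi => ?_
  have him : i < m := by omega
  rw [extendSeq, extendSeq, dif_pos him, dif_pos (by omega)]
  exact Fin.snoc_castSucc (α := fun _ => O) a o ⟨i, him⟩

theorem orderedProd_apply_eq_sum [Fintype O] [Inhabited O] (T : ℕ → Module.End R (X → R))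
    (wt : ℕ → X → O → R) (step : ℕ → X → O → X)
    (hT : ∀ k f x, T k f x = ∑ o, wt k x o * f (step k x o)) (m : ℕ) (f : X → R) (x : X) :
    orderedProd T 0 m f x = ∑ o : Fin m → O,
      (∏ k : Fin m, wt k (runSteps step x (extendSeq o) k) (o k)) *
        f (runSteps step x (extendSeq o) m) := by
  induction m generalizing f with
  | zero => simp [runSteps]
  | succ m ih =>
    rw [orderedProd_succ, Module.End.mul_apply, ih, Nat.zero_add,
      ← (Fin.snocEquiv fun _ => O).sum_comp, Fintype.sum_prod_type, Finset.sum_comm]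
    refine Finset.sum_congr rfl fun o _ => ?_
    rw [hT, Finset.mul_sum]
    refine Finset.sum_congr rfl fun a _ => ?_
    have hlast : extendSeq (Fin.snoc o a : Fin (m + 1) → O) m = a :=
      (extendSeq_val _ (Fin.last m)).trans (Fin.snoc_last (α := fun _ => O) a o)
    change _ = (∏ k : Fin (m + 1), wt k (runSteps step x (extendSeq (Fin.snoc o a)) k)
      ((Fin.snoc o a : Fin (m + 1) → O) k)) * f (runSteps step x (extendSeq (Fin.snoc o a)) (m + 1))
    rw [Fin.prod_univ_castSucc, runSteps, hlast, runSteps_extendSeq_snoc step x o a le_rfl]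
    simp only [Fin.val_castSucc, Fin.val_last, Fin.snoc_castSucc, Fin.snoc_last,
      runSteps_extendSeq_snoc step x o a (Fin.is_le'), runSteps_extendSeq_snoc step x o a le_rfl,
      mul_assoc]

end Expansion

section Network

variable {n : ℕ}

/-- The `k`-th edge of the `r`-th horizontal line from the top. -/
def horizEdge (c : Config n) (r k : ℕ) : Bool :=
  if h : r < n ∧ k ≤ n then c.1 ⟨k, by omega⟩ ⟨n - 1 - r, by omega⟩ else false

/-- The `m`-th edge, from the top, of the `i`-th vertical line. -/
def vertEdge (c : Config n) (i m : ℕ) : Bool :=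
  if h : i < n ∧ m ≤ n then c.2.1 ⟨i, h.1⟩ ⟨n - m, by omega⟩ else false

/-- The edge of the diagonal `e` which enters column `k`. -/
def diagEdge (c : Config n) (e : ℤ) (k : ℕ) : Bool :=
  if h : k ≤ n ∧ 0 ≤ n + e - k ∧ n + e - k ≤ n then
    c.2.2 ⟨k, by omega⟩ ⟨(n + e - k).toNat, by omega⟩ else false

theorem horizEdge_eq (c : Config n) {r k : ℕ} (K : Fin (n + 1)) (j : Fin n) (hk : K.val = k)
    (hj : j.val + r + 1 = n) : horizEdge c r k = c.1 K j := by
  rw [horizEdge, dif_pos (by omega)]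
  exact congrArg₂ c.1 (Fin.ext (by dsimp only; omega)) (Fin.ext (by dsimp only; omega))

theorem vertEdge_eq (c : Config n) {i m : ℕ} (I : Fin n) (l : Fin (n + 1)) (hi : I.val = i)
    (hl : l.val + m = n) : vertEdge c i m = c.2.1 I l := by
  rw [vertEdge, dif_pos (by omega)]
  exact congrArg₂ c.2.1 (Fin.ext (by dsimp only; omega)) (Fin.ext (by dsimp only; omega))

theorem diagEdge_eq (c : Config n) {e : ℤ} {k : ℕ} (K l : Fin (n + 1)) (hk : K.val = k)
    (hl : (l.val : ℤ) = n + e - k) : diagEdge c e k = c.2.2 K l := by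
  rw [diagEdge, dif_pos (by omega)]
  exact congrArg₂ c.2.2 (Fin.ext (by dsimp only; omega)) (Fin.ext (by dsimp only; omega))

/-- The state of the lines of the configuration `c` after the nodes of the first `r` rows (from the
top) and the first `i` nodes of the following row. -/
def lineState (c : Config n) (r i : ℕ) : LineState
  | .horiz r' => horizEdge c r' (if r' < r then n else if r' = r then i else 0)
  | .vert i' => vertEdge c i' (if i' < i then r + 1 else r)
  | .diag e => diagEdge c e (min (n : ℤ) (r + e + if r + e < i then 1 else 0)).toNat

/-- Occupation of the edges exiting the node in row `r` (from the top) and column `i`, in the order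
horizontal, vertical, diagonal. -/
def outTriple (c : Config n) (r i : Fin n) : Bool × Bool × Bool :=
  (outEdge c i r.rev .east, outEdge c i r.rev .south, outEdge c i r.rev .southeast)

theorem lineState_horiz (c : Config n) (r i : Fin n) :
    lineState c r i (.horiz r) = inEdge c i r.rev .west := by
  simp only [lineState, lt_irrefl, if_false, if_true]
  exact horizEdge_eq c _ _ rfl (by rw [Fin.val_rev]; omega)

theorem lineState_vert (c : Config n) (r i : Fin n) :
    lineState c r i (.vert i) = inEdge c i r.rev .north := by
  simp only [lineState, lt_irrefl, if_false]
  exact vertEdge_eq c _ _ rfl (by rw [Fin.val_succ, Fin.val_rev]; omega)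

theorem lineState_diag (c : Config n) (r i : Fin n) :
    lineState c r i (.diag ((i : ℤ) - r)) = inEdge c i r.rev .northwest := by
  refine diagEdge_eq c _ _ ?_ ?_ <;> rw [if_neg (by omega)] <;>
    simp only [Fin.val_castSucc, Fin.val_succ, Fin.val_rev] <;> omega

theorem lineState_succ_horiz (c : Config n) (r i : Fin n) :
    lineState c r (i + 1) (.horiz r) = outEdge c i r.rev .east := by
  simp only [lineState, lt_irrefl, if_false, if_true]
  exact horizEdge_eq c _ _ rfl (by rw [Fin.val_rev]; omega)

theorem lineState_succ_vert (c : Config n) (r i : Fin n) :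
    lineState c r (i + 1) (.vert i) = outEdge c i r.rev .south := by
  simp only [lineState, Nat.lt_succ_self, if_true]
  exact vertEdge_eq c _ _ rfl (by rw [Fin.val_castSucc, Fin.val_rev]; omega)

theorem lineState_succ_diag (c : Config n) (r i : Fin n) :
    lineState c r (i + 1) (.diag ((i : ℤ) - r)) = outEdge c i r.rev .southeast := by
  refine diagEdge_eq c _ _ ?_ ?_ <;> rw [if_pos (by push_cast; omega)] <;>
    simp only [Fin.val_castSucc, Fin.val_succ, Fin.val_rev] <;> omega

theorem lineState_succ_of_ne (c : Config n) (r i : Fin n) {l : Line} (hh : l ≠ .horiz r)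
    (hv : l ≠ .vert i) (hd : l ≠ .diag ((i : ℤ) - r)) :
    lineState c r (i + 1) l = lineState c r i l := by
  rcases l with r' | i' | e
  · have hne : r' ≠ r := by simpa using hh
    simp only [lineState, if_neg hne]
  · have hne : i' ≠ i := by simpa using hv
    simp only [lineState, show i' < (i : ℕ) + 1 ↔ i' < i by omega]
  · have hne : e ≠ (i : ℤ) - r := by simpa using hd
    simp only [lineState, show (r + e < ((i + 1 : ℕ) : ℤ)) ↔ r + e < (i : ℕ) by push_cast; omega]

theorem update_lineState_outTriple (c : Config n) (r i : Fin n) :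
    Function.update (Function.update (Function.update (lineState c r i) (.horiz r)
      (outTriple c r i).1) (.vert i) (outTriple c r i).2.1) (.diag ((i : ℤ) - r))
      (outTriple c r i).2.2 = lineState c r (i + 1) := by
  funext l
  by_cases hd : l = .diag ((i : ℤ) - r)
  · rw [hd, Function.update_self, lineState_succ_diag, outTriple]
  rw [Function.update_of_ne hd]
  by_cases hv : l = .vert i
  · rw [hv, Function.update_self, lineState_succ_vert, outTriple]
  rw [Function.update_of_ne hv]
  by_cases hh : l = .horiz r
  · rw [hh, Function.update_self, lineState_succ_horiz, outTriple]
  rw [Function.update_of_ne hh, lineState_succ_of_ne c r i hh hv hd]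

theorem lineState_succ_zero (c : Config n) {r : ℕ} (hr : r < n) :
    lineState c (r + 1) 0 = lineState c r n := by
  funext l
  rcases l with r' | i' | e
  · simp only [lineState]
    congr 1
    split_ifs <;> omega
  · simp only [lineState, Nat.not_lt_zero, if_false]
    by_cases h : i' < n
    · rw [if_pos h]
    · rw [vertEdge, vertEdge, dif_neg (by omega), dif_neg (by omega)]
  · simp only [lineState]
    congr 1
    push_cast
    split_ifs <;> omega

theorem lineState_zero_horiz (c : Config n) (j : Fin n) :
    lineState c 0 0 (.horiz j.rev) = c.1 0 j := by
  simp only [lineState, Nat.not_lt_zero, if_false, ite_self]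
  exact horizEdge_eq c _ _ rfl (by rw [Fin.val_rev]; omega)

theorem lineState_zero_vert (c : Config n) (i : Fin n) :
    lineState c 0 0 (.vert i) = c.2.1 i (Fin.last n) := by
  simp only [lineState, Nat.not_lt_zero, if_false]
  exact vertEdge_eq c _ _ rfl rfl

theorem lineState_zero_diag_left (c : Config n) (l : Fin (n + 1)) :
    lineState c 0 0 (.diag ((l : ℤ) - n)) = c.2.2 0 l := by
  have hzero : ((0 : Fin (n + 1)) : ℕ) = 0 := rfl
  refine diagEdge_eq c _ _ ?_ ?_ <;> push_cast <;> split_ifs <;> omega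

theorem lineState_zero_diag_top (c : Config n) (k : Fin (n + 1)) :
    lineState c 0 0 (.diag k) = c.2.2 k (Fin.last n) := by
  refine diagEdge_eq c _ _ ?_ ?_ <;> push_cast <;> rw [if_neg (by omega)] <;> omega

theorem lineState_last_horiz (c : Config n) (j : Fin n) :
    lineState c n 0 (.horiz j.rev) = c.1 (Fin.last n) j := by
  simp only [lineState, Fin.is_lt, if_true]
  exact horizEdge_eq c _ _ rfl (by rw [Fin.val_rev]; omega)

theorem lineState_last_vert (c : Config n) (i : Fin n) :
    lineState c n 0 (.vert i) = c.2.1 i 0 := by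
  simp only [lineState, Nat.not_lt_zero, if_false]
  exact vertEdge_eq c _ _ rfl (zero_add n)

theorem lineState_last_diag_bottom (c : Config n) (k : Fin (n + 1)) :
    lineState c n 0 (.diag ((k : ℤ) - n)) = c.2.2 k 0 := by
  have hzero : ((0 : Fin (n + 1)) : ℕ) = 0 := rfl
  refine diagEdge_eq c _ _ ?_ ?_ <;> push_cast <;> split_ifs <;> omega

theorem lineState_last_diag_right (c : Config n) (l : Fin (n + 1)) :
    lineState c n 0 (.diag l) = c.2.2 (Fin.last n) l := by
  have hlast : (Fin.last n).val = n := rfl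
  refine diagEdge_eq c _ _ ?_ ?_ <;> push_cast <;> rw [if_neg (by omega)] <;> omega

/-- The line states which vanish on the lines that do not meet the square. -/
structure IsBoundaryState (n : ℕ) (x : LineState) : Prop where
  horiz : ∀ r, n ≤ r → x (.horiz r) = false
  vert : ∀ i, n ≤ i → x (.vert i) = false
  diag : ∀ e : ℤ, e < -n ∨ n < e → x (.diag e) = false

theorem isBoundaryState_lineState (c : Config n) (r : ℕ) : IsBoundaryState n (lineState c r 0) where
  horiz r' h := by rw [lineState, horizEdge, dif_neg (by omega)]
  vert i h := by rw [lineState, vertEdge, dif_neg (by omega)]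
  diag e h := by
    rw [lineState, diagEdge, dif_neg]
    push_cast
    split_ifs <;> omega

theorem isBoundaryState_inState (n : ℕ) : IsBoundaryState n (inState n) where
  horiz r h := decide_eq_false (by omega)
  vert _ _ := rfl
  diag e h := decide_eq_false (by omega)

theorem isBoundaryState_outState (n : ℕ) : IsBoundaryState n (outState n) where
  horiz _ _ := rfl
  vert i h := decide_eq_false (by omega)
  diag e h := decide_eq_false (by omega)

theorem IsBoundaryState.ext_iff {x y : LineState} (hx : IsBoundaryState n x)
    (hy : IsBoundaryState n y) : x = y ↔
      (∀ j : Fin n, x (.horiz j.rev) = y (.horiz j.rev)) ∧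
      (∀ i : Fin n, x (.vert i) = y (.vert i)) ∧
      (∀ l : Fin (n + 1), x (.diag ((l : ℤ) - n)) = y (.diag ((l : ℤ) - n))) ∧
      ∀ k : Fin (n + 1), x (.diag k) = y (.diag k) := by
  refine ⟨by rintro rfl; simp, fun ⟨hhoriz, hvert, hneg, hnonneg⟩ => funext fun l => ?_⟩
  rcases l with r | i | e
  · by_cases h : r < n
    · simpa only [Fin.rev_rev] using hhoriz (Fin.rev ⟨r, h⟩)
    · rw [hx.horiz r (by omega), hy.horiz r (by omega)]
  · by_cases h : i < n
    · exact hvert ⟨i, h⟩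
    · rw [hx.vert i (by omega), hy.vert i (by omega)]
  · by_cases h : e < -n ∨ n < e
    · rw [hx.diag e h, hy.diag e h]
    · rcases le_total e 0 with he | he
      · obtain ⟨l, rfl⟩ : ∃ l : Fin (n + 1), e = (l : ℤ) - n :=
          ⟨⟨(n + e).toNat, by omega⟩, by dsimp only; omega⟩
        exact hneg l
      · obtain ⟨k, rfl⟩ : ∃ k : Fin (n + 1), e = k := ⟨⟨e.toNat, by omega⟩, by dsimp only; omega⟩
        exact hnonneg k

/-- The configuration with line state `x` on the upper left boundary and with given occupation of
the edges exiting the nodes. -/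
def configOf (x : LineState) (o : Fin n → Fin n → Bool × Bool × Bool) : Config n :=
  (fun k j => Fin.cases (x (.horiz j.rev)) (fun i => (o j.rev i).1) k,
    fun i l => Fin.lastCases (x (.vert i)) (fun j => (o j.rev i).2.1) l,
    fun k l => Fin.cases (x (.diag ((l : ℤ) - n)))
      (fun i => Fin.lastCases (x (.diag ((i : ℤ) + 1))) (fun j => (o j.rev i).2.2) l) k)

theorem outTriple_configOf (x : LineState) (o : Fin n → Fin n → Bool × Bool × Bool) :
    outTriple (configOf x o) = o := by
  funext r i
  simp [outTriple, configOf, outEdge]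

theorem configOf_lineState (c : Config n) : configOf (lineState c 0 0) (outTriple c) = c := by
  refine Prod.ext (funext₂ fun k j => ?_) (Prod.ext (funext₂ fun i l => ?_) (funext₂ fun k l => ?_))
  · induction k using Fin.cases with
    | zero => exact lineState_zero_horiz c j
    | succ i => simp [configOf, outTriple, outEdge]
  · induction l using Fin.lastCases with
    | last => simpa [configOf] using lineState_zero_vert c i
    | cast j => simp [configOf, outTriple, outEdge]
  · induction k using Fin.cases with
    | zero => exact lineState_zero_diag_left c l
    | succ i =>
      induction l using Fin.lastCases with
      | last => simpa [configOf] using lineState_zero_diag_top c i.succ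
      | cast j => simp [configOf, outTriple, outEdge]

theorem lineState_configOf {x : LineState} (hx : IsBoundaryState n x)
    (o : Fin n → Fin n → Bool × Bool × Bool) : lineState (configOf x o) 0 0 = x := by
  refine ((isBoundaryState_lineState _ 0).ext_iff hx).mpr
    ⟨fun j => ?_, fun i => ?_, fun l => ?_, fun k => ?_⟩
  · rw [lineState_zero_horiz]
    simp only [configOf, Fin.cases_zero]
  · rw [lineState_zero_vert]
    simp only [configOf, Fin.lastCases_last]
  · rw [lineState_zero_diag_left]
    simp only [configOf, Fin.cases_zero]
  · rw [lineState_zero_diag_top]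
    induction k using Fin.cases with
    | zero => simp [configOf]
    | succ i => simp [configOf]

end Network

section PartitionFunctions

variable {R : Type*} [CommSemiring R] {n : ℕ}

/-- The operator of the triple crossing in column `i` and row `r`, with weights depending on the
row. -/
def rowNodeOp (M : ℕ → NodeWeight R) (i r : ℕ) : LineOp R :=
  nodeOp (M r) (.horiz r) (.vert i) (.diag (i - r))

/-- The product of the node weights of a configuration, the weights in row `r` from the top being
`M r`. -/
def rowWeight (M : ℕ → NodeWeight R) (c : Config n) : R :=
  ∏ i : Fin n, ∏ j : Fin n, M j.rev (inEdge c i j .west) (inEdge c i j .north)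
    (inEdge c i j .northwest) (outEdge c i j .east) (outEdge c i j .south)
    (outEdge c i j .southeast)

/-- The product of the node weights of a configuration on the square grid, the weights in row `r`
from the top being `m r`. -/
def rowWeight6V (m : ℕ → PairWeight R) (e : Config6V n) : R :=
  ∏ i : Fin n, ∏ j : Fin n, m j.rev (inEdge6V e i j .west) (inEdge6V e i j .north)
    (outEdge6V e i j .east) (outEdge6V e i j .south)

/-- The line state below a node in column `i` and row `r`, the occupation of the exiting edges
being `o`. -/
def crossNode (r i : ℕ) (x : LineState) (o : Bool × Bool × Bool) : LineState :=
  Function.update (Function.update (Function.update x (.horiz r) o.1) (.vert i) o.2.1)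
    (.diag ((i : ℤ) - r)) o.2.2

/-- The line state below the row `r`, the occupation of the exiting edges being `o`. -/
def crossRow (n r : ℕ) (x : LineState) (o : Fin n → Bool × Bool × Bool) : LineState :=
  runSteps (crossNode r) x (extendSeq o) n

theorem runSteps_crossNode (c : Config n) (r : Fin n) {i : ℕ} (hi : i ≤ n) :
    runSteps (crossNode r) (lineState c r 0) (extendSeq (outTriple c r)) i = lineState c r i := by
  induction i with
  | zero => rfl
  | succ i ih =>
    rw [runSteps, ih (by omega), show extendSeq (outTriple c r) i = outTriple c r ⟨i, hi⟩ from
      extendSeq_val (outTriple c r) ⟨i, hi⟩]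
    exact update_lineState_outTriple c r ⟨i, hi⟩

theorem runSteps_crossRow (c : Config n) {r : ℕ} (hr : r ≤ n) :
    runSteps (crossRow n) (lineState c 0 0) (extendSeq (outTriple c)) r = lineState c r 0 := by
  induction r with
  | zero => rfl
  | succ r ih =>
    rw [runSteps, ih (by omega), lineState_succ_zero c hr, show extendSeq (outTriple c) r =
      outTriple c ⟨r, hr⟩ from extendSeq_val (outTriple c) ⟨r, hr⟩]
    exact runSteps_crossNode c ⟨r, hr⟩ le_rfl

open Classical in
theorem gridProd_rowNodeOp_apply (M : ℕ → NodeWeight R) {x : LineState}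
    (hx : IsBoundaryState n x) (f : LineState → R) :
    gridProd n (rowNodeOp M) f x =
      ∑ c : Config n with lineState c 0 0 = x, rowWeight M c * f (lineState c n 0) := by
  set wt : ℕ → ℕ → LineState → Bool × Bool × Bool → R := fun r i x o =>
    M r (x (.horiz r)) (x (.vert i)) (x (.diag ((i : ℤ) - r))) o.1 o.2.1 o.2.2 with hwt
  have hrow (r : ℕ) (f : LineState → R) (x : LineState) :
      orderedProd (fun i => rowNodeOp M i r) 0 n f x = ∑ o : Fin n → Bool × Bool × Bool,
        (∏ i : Fin n, wt r i (runSteps (crossNode r) x (extendSeq o) i) (o i)) *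
          f (crossRow n r x o) :=
    orderedProd_apply_eq_sum _ (wt r) (crossNode r) (fun _ _ _ => rfl) n f x
  rw [gridProd, orderedProd_apply_eq_sum _ _ (crossRow n) hrow]
  refine (Finset.sum_bij' (fun c _ => outTriple c) (fun o _ => configOf x o)
    (fun c _ => Finset.mem_univ _)
    (fun o _ => Finset.mem_filter.mpr ⟨Finset.mem_univ _, lineState_configOf hx o⟩)
    (fun c hc => ?_) (fun o _ => outTriple_configOf x o) fun c hc => ?_).symm
  · rw [← (Finset.mem_filter.mp hc).2]
    exact configOf_lineState c
  · obtain rfl := (Finset.mem_filter.mp hc).2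
    rw [runSteps_crossRow c le_rfl, rowWeight, Finset.prod_comm]
    refine congrArg (· * _) (Fintype.prod_equiv Fin.revPerm _ _ fun j =>
      Finset.prod_congr rfl fun i _ => ?_)
    rw [runSteps_crossRow c (Fin.is_lt _).le, runSteps_crossNode c _ i.is_lt.le, hwt]
    simp only [lineState_horiz, lineState_vert, lineState_diag, outTriple, Fin.revPerm_apply,
      Fin.rev_rev]

theorem dwbc2_iff {c : Config n} : DWBC2 c ↔
    ((∀ j, c.1 0 j = true) ∧ (∀ i, c.2.1 i (Fin.last n) = false) ∧
      (∀ l, c.2.2 0 l = decide (0 < l.val ∧ l.val < n)) ∧ ∀ k, c.2.2 k (Fin.last n) = false) ∧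
    (∀ j, c.1 (Fin.last n) j = false) ∧ (∀ i, c.2.1 i 0 = true) ∧
      (∀ k, c.2.2 k 0 = decide (0 < k.val ∧ k.val < n)) ∧ ∀ l, c.2.2 (Fin.last n) l = false := by
  have hinner (l : Fin (n + 1)) : l ≠ 0 ∧ l ≠ Fin.last n ↔ 0 < l.val ∧ l.val < n := by
    rw [← Fin.lt_last_iff_ne_last, ← Fin.pos_iff_ne_zero]
    rfl
  have hside {f : Fin (n + 1) → Bool} (h0 : f 0 = false) (hlast : f (Fin.last n) = false)
      (h : ∀ l, l ≠ 0 → l ≠ Fin.last n → f l = true) (l : Fin (n + 1)) :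
      f l = decide (0 < l.val ∧ l.val < n) := by
    by_cases hl : l ≠ 0 ∧ l ≠ Fin.last n
    · rw [h l hl.1 hl.2, decide_eq_true ((hinner l).mp hl)]
    · rw [decide_eq_false (mt (hinner l).mpr hl)]
      obtain rfl | rfl : l = 0 ∨ l = Fin.last n := by tauto
      exacts [h0, hlast]
  constructor
  · intro h
    exact ⟨⟨h.left, h.top, hside h.noEdge (h.diagTop 0) h.diagLeft, h.diagTop⟩,
      h.right, h.bottom, hside h.noEdge (h.diagRight 0) h.diagBottom, h.diagRight⟩
  · rintro ⟨⟨left, top, diagLeft, diagTop⟩, right, bottom, diagBottom, diagRight⟩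
    exact ⟨left, right, bottom, top,
      fun l h0 hl => (diagLeft l).trans (decide_eq_true ((hinner l).mp ⟨h0, hl⟩)),
      fun k h0 hk => (diagBottom k).trans (decide_eq_true ((hinner k).mp ⟨h0, hk⟩)),
      diagTop, diagRight, by simpa using diagLeft 0⟩

theorem dwbc2_iff_lineState {c : Config n} :
    DWBC2 c ↔ lineState c 0 0 = inState n ∧ lineState c n 0 = outState n := by
  have hdiag (l : ℕ) : decide (-(n : ℤ) < l - n ∧ (l : ℤ) - n < 0) = decide (0 < l ∧ l < n) :=
    decide_eq_decide.mpr (by omega)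
  have hcorner (k : ℕ) : decide (-(n : ℤ) < k ∧ (k : ℤ) < 0) = false := decide_eq_false (by omega)
  rw [dwbc2_iff, (isBoundaryState_lineState c 0).ext_iff (isBoundaryState_inState n),
    (isBoundaryState_lineState c n).ext_iff (isBoundaryState_outState n)]
  simp only [lineState_zero_horiz, lineState_zero_vert, lineState_zero_diag_left,
    lineState_zero_diag_top, lineState_last_horiz, lineState_last_vert, lineState_last_diag_bottom,
    lineState_last_diag_right, inState, outState, hdiag, hcorner, Fin.is_lt, decide_true]

open Classical in
theorem wallElement_gridProd_rowNodeOp (n : ℕ) (M : ℕ → NodeWeight R) :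
    wallElement n (gridProd n (rowNodeOp M)) = ∑ c : Config n with DWBC2 c, rowWeight M c := by
  rw [wallElement, gridProd_rowNodeOp_apply M (isBoundaryState_inState n)]
  simp only [dwbc2_iff_lineState, Finset.sum_filter, Set.indicator_apply, Set.mem_singleton_iff,
    Pi.one_apply, mul_ite, mul_one, mul_zero, ite_and]

/-- The domain wall boundary condition on the square grid. -/
structure DWBC6V (e : Config6V n) : Prop where
  left : ∀ j, e.1 0 j = true
  right : ∀ j, e.1 (Fin.last n) j = false
  bottom : ∀ i, e.2 i 0 = true
  top : ∀ i, e.2 i (Fin.last n) = false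

/-- The occupation of the diagonal edges when no diagonal path bends. -/
def straightDiag (n : ℕ) (k l : Fin (n + 1)) : Bool :=
  decide (0 < k.val + l.val ∧ k.val + l.val < n)

theorem dwbc2_straightDiag {e : Config6V n} :
    DWBC2 ((e.1, e.2, straightDiag n) : Config n) ↔ DWBC6V e := by
  refine ⟨fun h => ⟨h.left, h.right, h.bottom, h.top⟩, fun h => dwbc2_iff.mpr
    ⟨⟨h.left, h.top, fun l => ?_, fun k => ?_⟩, h.right, h.bottom, fun k => ?_, fun l => ?_⟩⟩ <;>
  simp [straightDiag]

theorem southeast_eq_northwest_iff {c : Config n} (h : DWBC2 c) :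
    (∀ i j, outEdge c i j .southeast = inEdge c i j .northwest) ↔ c.2.2 = straightDiag n := by
  obtain ⟨⟨-, -, hleft, htop⟩, -⟩ := dwbc2_iff.mp h
  constructor
  · intro hstraight
    funext k
    induction k using Fin.induction with
    | zero => exact funext fun l => (hleft l).trans (by simp [straightDiag])
    | succ i ih =>
      funext l
      induction l using Fin.lastCases with
      | last => simp [htop, straightDiag]
      | cast j =>
        refine (hstraight i j).trans ((congrFun ih j.succ).trans (decide_eq_decide.mpr ?_))
        simp only [Fin.val_castSucc, Fin.val_succ]
        omega
  · intro hc i j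
    simp only [outEdge, inEdge, hc, straightDiag, Fin.val_castSucc, Fin.val_succ, decide_eq_decide]
    omega

open Classical in
theorem sum_rowWeight_straight (n : ℕ) (m : ℕ → PairWeight R) :
    ∑ c : Config n with DWBC2 c,
        rowWeight (fun r h v d p q u => if u = d then m r h v p q else 0) c =
      ∑ e : Config6V n with DWBC6V e, rowWeight6V m e := by
  simp only [rowWeight, Finset.prod_ite_zero, Finset.mem_univ, forall_true_left]
  rw [← Finset.sum_filter, Finset.filter_filter,
    Finset.filter_congr fun c _ => and_congr_right southeast_eq_northwest_iff]
  refine Finset.sum_nbij' (fun c => (c.1, c.2.1)) (fun e => (e.1, e.2, straightDiag n))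
    (fun c hc => ?_) (fun e he => ?_) (fun c hc => ?_) (fun e _ => rfl) fun c _ => rfl
  · obtain ⟨h, -⟩ := (Finset.mem_filter.mp hc).2
    exact Finset.mem_filter.mpr ⟨Finset.mem_univ _, h.left, h.right, h.bottom, h.top⟩
  · exact Finset.mem_filter.mpr
      ⟨Finset.mem_univ _, dwbc2_straightDiag.mpr (Finset.mem_filter.mp he).2, rfl⟩
  · rw [← (Finset.mem_filter.mp hc).2.2]

open Classical in
theorem sum_rowWeight_triangleUpper (n : ℕ) {mX mY : ℕ → PairWeight R} {mW : PairWeight R}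
    (hYB : ∀ r, triangleUpper (mX r) (mY r) mW = triangleLower (mX r) (mY r) mW)
    (hY : ∀ r, IsFrozen (mY r)) (hW : IsFrozen mW) :
    ∑ c : Config n with DWBC2 c, rowWeight (fun r => triangleUpper (mX r) (mY r) mW) c =
      ∑ e : Config6V n with DWBC6V e, rowWeight6V mX e := by
  have hcross : gridProd n (crossOp mX) = gridProd n
      (rowNodeOp fun r h v d p q u => if u = d then mX r h v p q else 0) :=
    gridProd_congr fun i r _ _ => pairOp_eq_nodeOp (mX r) (by simp) (by simp)
  calc ∑ c : Config n with DWBC2 c, rowWeight (fun r => triangleUpper (mX r) (mY r) mW) c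
      = wallElement n (gridProd n (tripleOp mX mY mW)) := by
        rw [← wallElement_gridProd_rowNodeOp]
        exact congrArg _ (gridProd_congr fun i r _ _ => (tripleOp_eq_nodeOp i r).symm)
    _ = ∑ e : Config6V n with DWBC6V e, rowWeight6V mX e := by
        rw [wallElement_gridProd_tripleOp n hYB hY hW, hcross, wallElement_gridProd_rowNodeOp,
          sum_rowWeight_straight]

end PartitionFunctions

/-! ## The row of the uppermost path -/

section TopRow

variable {n : ℕ}

theorem exists_eq_decide_le {h : Fin (n + 1) → Bool} (h_zero : h 0 = true)
    (h_last : h (Fin.last n) = false) (h_anti : Antitone h) :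
    ∃ L : Fin n, ∀ k : Fin (n + 1), h k = decide (k.val ≤ L.val) := by
  obtain ⟨L, hL, hL'⟩ : ∃ L : Fin n, h L.castSucc = true ∧ h L.succ = false := by
    by_contra! hne
    have h_true : ∀ k, h k = true :=
      Fin.induction h_zero fun i hi => by simpa using hne i hi
    simp [h_true] at h_last
  refine ⟨L, fun k => ?_⟩
  by_cases hk : k ≤ L.castSucc
  · have h_le := h_anti hk
    rw [hL] at h_le
    simpa [Bool.eq_true_of_true_le h_le, Fin.le_def] using hk
  · have h_le := h_anti (Fin.castSucc_lt_iff_succ_le.1 (not_le.1 hk))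
    rw [hL'] at h_le
    simpa [Bool.eq_false_of_le_false h_le, Fin.lt_def] using not_le.1 hk

/-- The top row of a 20V configuration whose uppermost path leaves the top line in column `L`, by a
diagonal step if `b = true` and by a vertical step if `b = false`. -/
structure TopRow (c : Config (n + 1)) (L : Fin (n + 1)) (b : Bool) : Prop where
  north : ∀ i, inEdge c i (Fin.last n) .north = false
  northwest : ∀ i, inEdge c i (Fin.last n) .northwest = false
  west : ∀ i, inEdge c i (Fin.last n) .west = decide (i ≤ L)
  east : ∀ i, outEdge c i (Fin.last n) .east = decide (i < L)
  southeast : ∀ i, outEdge c i (Fin.last n) .southeast = (decide (i = L) && b)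
  south : ∀ i, outEdge c i (Fin.last n) .south = (decide (i = L) && !b)

theorem exists_topRow {c : Config (n + 1)} (hc : IsConfig20V c) : ∃ L b, TopRow c L b := by
  have north : ∀ i, inEdge c i (Fin.last n) .north = false := hc.1.top
  have northwest : ∀ i, inEdge c i (Fin.last n) .northwest = false := fun i => hc.1.diagTop _
  have ice : ∀ i, (inEdge c i (Fin.last n) .west).toNat =
      (outEdge c i (Fin.last n) .east).toNat + (outEdge c i (Fin.last n) .southeast).toNat +
        (outEdge c i (Fin.last n) .south).toNat := fun i => by
    simpa [IceRule, north, northwest] using hc.2 i (Fin.last n)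
  have east_le_west : ∀ w e d s : Bool, w.toNat = e.toNat + d.toNat + s.toNat → e ≤ w := by decide
  obtain ⟨L, hL⟩ := exists_eq_decide_le (h := fun k => c.1 k (Fin.last n)) (hc.1.left _)
    (hc.1.right _) (Fin.antitone_iff_succ_le.2 fun i => east_le_west _ _ _ _ (ice i))
  have west : ∀ i, inEdge c i (Fin.last n) .west = decide (i ≤ L) := fun i => hL i.castSucc
  have east : ∀ i, outEdge c i (Fin.last n) .east = decide (i < L) := fun i => hL i.succ
  have exits : ∀ i, outEdge c i (Fin.last n) .southeast =
        (decide (i = L) && outEdge c L (Fin.last n) .southeast) ∧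
      outEdge c i (Fin.last n) .south =
        (decide (i = L) && !outEdge c L (Fin.last n) .southeast) := fun i => by
    have h_ice := ice i
    rw [west, east] at h_ice
    rcases lt_trichotomy i L with hi | rfl | hi
    · simpa [hi, hi.le, hi.ne, add_assoc] using h_ice
    · revert h_ice
      cases outEdge c i (Fin.last n) .southeast <;> cases outEdge c i (Fin.last n) .south <;> simp
    · simpa [hi.not_gt, hi.not_ge, hi.ne'] using h_ice.symm
  exact ⟨L, _, north, northwest, west, east, fun i => (exits i).1, fun i => (exits i).2⟩

namespace TopRow

variable {c : Config (n + 1)} {L : Fin (n + 1)} {b : Bool}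

theorem onUppermost_west (h : TopRow c L b) {i : Fin (n + 1)} (hi : i ≤ L) :
    OnUppermost c i (Fin.last n) .west := by
  induction i using Fin.induction with
  | zero => exact .start _ _ rfl rfl
  | succ i ih =>
    have hiL : i.castSucc < L := Fin.castSucc_lt_iff_succ_le.2 hi
    refine .east i.castSucc _ _ .west (ih hiL.le) ⟨?_, ?_, ?_⟩ rfl
    · simp [h.west, hiL.le]
    · simp [h.east, hiL]
    · simp [inAbove, outAbove, h.north, h.northwest]

theorem leavesTop_iff (h : TopRow c L b) {L' : Fin (n + 1)} {b' : Bool} :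
    LeavesTop c L' (bif b' then .southeast else .south) ↔ L' = L ∧ b' = b := by
  constructor
  · rintro ⟨-, j, a, hj, -, -, h_out, -⟩
    obtain rfl : j = Fin.last n := Fin.ext (Nat.succ_injective hj)
    cases b' <;> simpa [h.south, h.southeast] using h_out
  · rintro ⟨rfl, rfl⟩
    refine ⟨by cases b' <;> simp, Fin.last n, .west, rfl, h.onUppermost_west le_rfl, ?_, ?_, ?_⟩
    · simp [h.west]
    · cases b' <;> simp [h.south, h.southeast]
    · cases b' <;> simp [inAbove, outAbove, h.north, h.northwest, h.east, h.southeast]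

end TopRow

/-- The top row of a 6V configuration whose uppermost path leaves the top line in column `L`. -/
structure TopRow6V (e : Config6V (n + 1)) (L : Fin (n + 1)) : Prop where
  north : ∀ i, inEdge6V e i (Fin.last n) .north = false
  west : ∀ i, inEdge6V e i (Fin.last n) .west = decide (i ≤ L)
  east : ∀ i, outEdge6V e i (Fin.last n) .east = decide (i < L)
  south : ∀ i, outEdge6V e i (Fin.last n) .south = decide (i = L)

theorem exists_topRow6V {e : Config6V (n + 1)} (he : IsConfig6V e) : ∃ L, TopRow6V e L := by
  have north : ∀ i, inEdge6V e i (Fin.last n) .north = false := he.top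
  have ice : ∀ i, (inEdge6V e i (Fin.last n) .west).toNat =
      (outEdge6V e i (Fin.last n) .east).toNat +
        (outEdge6V e i (Fin.last n) .south).toNat := fun i => by
    simpa [north] using he.ice i (Fin.last n)
  have east_le_west : ∀ w e s : Bool, w.toNat = e.toNat + s.toNat → e ≤ w := by decide
  obtain ⟨L, hL⟩ := exists_eq_decide_le (h := fun k => e.1 k (Fin.last n)) (he.left _)
    (he.right _) (Fin.antitone_iff_succ_le.2 fun i => east_le_west _ _ _ (ice i))
  have west : ∀ i, inEdge6V e i (Fin.last n) .west = decide (i ≤ L) := fun i => hL i.castSucc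
  have east : ∀ i, outEdge6V e i (Fin.last n) .east = decide (i < L) := fun i => hL i.succ
  refine ⟨L, north, west, east, fun i => ?_⟩
  have h_ice := ice i
  rw [west, east] at h_ice
  rcases lt_trichotomy i L with hi | rfl | hi
  · simpa [hi, hi.le, hi.ne] using h_ice
  · simpa using h_ice.symm
  · simpa [hi.not_gt, hi.not_ge, hi.ne'] using h_ice.symm

end TopRow

section Transpose

variable {n : ℕ}

/-- Reflection of the square grid in the diagonal `i = j`, exchanging incoming and outgoing
edges. -/
def transpose6V (n : ℕ) : Config6V n ≃ Config6V n where
  toFun e := (fun k j => e.2 j k, fun i l => e.1 l i)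
  invFun e := (fun k j => e.2 j k, fun i l => e.1 l i)
  left_inv _ := rfl
  right_inv _ := rfl

theorem IsConfig6V.transpose {e : Config6V n} (h : IsConfig6V e) :
    IsConfig6V (transpose6V n e) where
  left := h.bottom
  right := h.top
  bottom := h.left
  top := h.right
  ice i j := by
    simpa only [transpose6V, Equiv.coe_fn_mk, inEdge6V, outEdge6V, add_comm, eq_comm]
      using h.ice j i

theorem isConfig6V_transpose_iff {e : Config6V n} :
    IsConfig6V (transpose6V n e) ↔ IsConfig6V e :=
  ⟨fun h => h.transpose, fun h => h.transpose⟩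

theorem prod_weight6V_transpose (a b c : ℂ) (e : Config6V n) :
    (∏ i : Fin n, ∏ j : Fin n, weight6V a b c (inEdge6V (transpose6V n e) i j .north)
      (inEdge6V (transpose6V n e) i j .west) (outEdge6V (transpose6V n e) i j .east)
      (outEdge6V (transpose6V n e) i j .south)) =
    ∏ i : Fin n, ∏ j : Fin n, weight6V a b c (inEdge6V e i j .north) (inEdge6V e i j .west)
      (outEdge6V e i j .east) (outEdge6V e i j .south) := by
  have weight_reverse : ∀ N W E S : Bool, weight6V a b c E S N W = weight6V a b c N W E S := by
    rintro (_ | _) (_ | _) (_ | _) (_ | _) <;> rfl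
  rw [Finset.prod_comm]
  exact Finset.prod_congr rfl fun i _ => Finset.prod_congr rfl fun j _ => weight_reverse _ _ _ _

end Transpose

section LastColumn

variable {n : ℕ} {e : Config6V n}

theorem OnUppermost6V.inEdge_eq_true (he : IsConfig6V e) {i j : Fin n} {a : Inc6V}
    (h : OnUppermost6V e i j a) : inEdge6V e i j a = true := by
  cases h with
  | start _ _ hi _ =>
    have h_zero : i.castSucc = 0 := Fin.ext hi
    simpa only [inEdge6V, h_zero] using he.left j
  | east i₀ _ _ a _ hcont hi =>
    have h_succ : i.castSucc = i₀.succ := Fin.ext hi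
    rw [inEdge6V, h_succ]
    exact hcont.2.1
  | south _ j₀ _ a _ hcont hj =>
    have h_succ : j.succ = j₀.castSucc := Fin.ext hj
    rw [inEdge6V, h_succ]
    exact hcont.2.1

/-- The uppermost path enters the node `(i, j)` from the direction `a`, and no other path meets the
row `j` above it or to its right. -/
structure EntersRow6V (e : Config6V n) (i j : Fin n) (a : Inc6V) : Prop where
  onUppermost : OnUppermost6V e i j a
  inAbove : inAbove6V e i j a = 0
  north : ∀ i', i < i' → inEdge6V e i' j .north = false

/-- The uppermost path leaves the row `j` downwards at `(i, j)`, having entered this node from the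
direction `a`, and the row is empty to the right of `i`. -/
structure ExitsRow6V (e : Config6V n) (i j : Fin n) (a : Inc6V) : Prop where
  onUppermost : OnUppermost6V e i j a
  continues : Continues6V e i j a .south
  west : ∀ i', i < i' → inEdge6V e i' j .west = false
  south : ∀ i', i < i' → outEdge6V e i' j .south = false

theorem IsConfig6V.row_eq_false (he : IsConfig6V e) {i j : Fin n}
    (h_east : outEdge6V e i j .east = false)
    (h_north : ∀ i', i < i' → inEdge6V e i' j .north = false) {i' : Fin n} (hi : i < i') :
    inEdge6V e i' j .west = false ∧ outEdge6V e i' j .south = false := by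
  have exits_eq_false : ∀ i', i < i' → inEdge6V e i' j .west = false →
      outEdge6V e i' j .east = false ∧ outEdge6V e i' j .south = false := fun i' hi h_west => by
    simpa [h_north i' hi, h_west] using (he.ice i' j).symm
  have horizontal : ∀ k : Fin (n + 1), i.castSucc < k → e.1 k j = false := by
    intro k
    induction k using Fin.induction with
    | zero => exact fun h => absurd h (Fin.not_lt_zero _)
    | succ k ih =>
      intro hk
      rcases (Fin.castSucc_lt_succ_iff.1 hk).eq_or_lt with rfl | hlt
      · exact h_east
      · exact (exits_eq_false k hlt (ih (Fin.castSucc_lt_castSucc_iff.2 hlt))).1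
  have h_west := horizontal i'.castSucc (Fin.castSucc_lt_castSucc_iff.2 hi)
  exact ⟨h_west, (exits_eq_false i' hi h_west).2⟩

theorem EntersRow6V.exists_exitsRow (he : IsConfig6V e) {i j : Fin n} {a : Inc6V}
    (h : EntersRow6V e i j a) : ∃ i' a', ExitsRow6V e i' j a' := by
  have h_in := h.onUppermost.inEdge_eq_true he
  cases h_east : outEdge6V e i j .east
  · have south_of_enters : ∀ N W S : Bool, N.toNat + W.toNat = false.toNat + S.toNat →
        N = true ∨ W = true → S = true := by decide
    have h_south : outEdge6V e i j .south = true :=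
      south_of_enters _ _ _ (h_east ▸ he.ice i j) (by cases a; exacts [.inl h_in, .inr h_in])
    have h_row := fun i' (hi : i < i') => he.row_eq_false h_east h.north hi
    exact ⟨i, a, h.onUppermost, ⟨h_in, h_south, by simp [h.inAbove, outAbove6V, h_east]⟩,
      fun i' hi => (h_row i' hi).1, fun i' hi => (h_row i' hi).2⟩
  · have hi : i.val + 1 < n := by
      by_contra hge
      have h_last : i.succ = Fin.last n := Fin.ext (by simp; omega)
      simp [outEdge6V, h_last, he.right] at h_east
    have lt_next : i < ⟨i + 1, hi⟩ := Nat.lt_succ_self i.val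
    have h_next : EntersRow6V e ⟨i + 1, hi⟩ j .west :=
      ⟨.east i j _ a h.onUppermost ⟨h_in, h_east, h.inAbove⟩ rfl,
        by simp [inAbove6V, h.north _ lt_next], fun i' hi' => h.north i' (lt_next.trans hi')⟩
    exact h_next.exists_exitsRow he
termination_by n - i.val

theorem IsConfig6V.exists_exitsRow (he : IsConfig6V e) (j : Fin n) :
    ∃ i a, ExitsRow6V e i j a := by
  by_cases hj : j.val + 1 = n
  · have h_last : j.succ = Fin.last n := Fin.ext hj
    have north : ∀ i, inEdge6V e i j .north = false := fun i => by
      simpa only [inEdge6V, h_last] using he.top i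
    have h_start : EntersRow6V e ⟨0, j.pos⟩ j .west :=
      ⟨.start _ _ rfl hj, by simp [inAbove6V, north], fun i _ => north i⟩
    exact h_start.exists_exitsRow he
  · obtain ⟨i, a, h⟩ := he.exists_exitsRow ⟨j + 1, by omega⟩
    have h_enters : EntersRow6V e i j .north :=
      ⟨.south i _ j a h.onUppermost h.continues rfl, rfl, h.south⟩
    exact h_enters.exists_exitsRow he
termination_by n - j.val

theorem IsConfig6V.hitsRight_iff {e : Config6V (n + 1)} (he : IsConfig6V e) {L : Fin (n + 1)} :
    HitsRight6V e L ↔ inEdge6V e (Fin.last n) L .west = true := by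
  constructor
  · rintro ⟨i, hi, h_on⟩
    obtain rfl : i = Fin.last n := Fin.ext (Nat.succ_injective hi)
    exact h_on.inEdge_eq_true he
  · intro h_west
    obtain ⟨i, a, h⟩ := he.exists_exitsRow L
    obtain rfl : i = Fin.last n := by
      by_contra hi
      simp [h.west _ (Fin.lt_last_iff_ne_last.2 hi)] at h_west
    have h_east : outEdge6V e (Fin.last n) L .east = false := he.right L
    cases a with
    | west => exact ⟨Fin.last n, rfl, h.onUppermost⟩
    | north =>
      have h_north := h.continues.1
      have h_ice := he.ice (Fin.last n) L
      rw [h_north, h_west, h_east] at h_ice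
      exact absurd h_ice (by cases outEdge6V e (Fin.last n) L .south <;> decide)

theorem TopRow6V.hitsRight_transpose_iff {e : Config6V (n + 1)} (he : IsConfig6V e)
    {L L' : Fin (n + 1)} (h : TopRow6V e L) : HitsRight6V (transpose6V (n + 1) e) L' ↔ L' = L := by
  rw [he.transpose.hitsRight_iff, ← decide_eq_true_iff (p := L' = L), ← h.south L']
  rfl

end LastColumn

/-! ## Triangles of six-vertex weights -/

theorem isFrozen_inv_smul_sixWeight {K : Type*} [Field K] {a : K} (ha : a ≠ 0) (b c c' : K) :
    IsFrozen (a⁻¹ • sixWeight a b c c') := by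
  intro s p q
  cases s <;> cases p <;> cases q <;> simp [sixWeight, ha]

theorem sixWeight_eq_zero {R : Type*} [CommSemiring R] (a b c c' : R) {x y p q : Bool}
    (hne : x.toNat + y.toNat ≠ p.toNat + q.toNat) : sixWeight a b c c' x y p q = 0 := by
  cases x <;> cases y <;> cases p <;> cases q <;> first | rfl | exact absurd rfl hne

theorem triangleUpper_sixWeight_eq_zero {R : Type*} [CommSemiring R]
    {a₁ b₁ c₁ c₁' a₂ b₂ c₂ c₂' a₃ b₃ c₃ c₃' : R} {h v d p q u : Bool}
    (hne : h.toNat + v.toNat + d.toNat ≠ p.toNat + q.toNat + u.toNat) :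
    triangleUpper (sixWeight a₁ b₁ c₁ c₁') (sixWeight a₂ b₂ c₂ c₂') (sixWeight a₃ b₃ c₃ c₃')
      h v d p q u = 0 := by
  refine Finset.sum_eq_zero fun d' _ => Finset.sum_eq_zero fun v' _ =>
    Finset.sum_eq_zero fun h' _ => ?_
  by_cases hW : d.toNat + v.toNat = d'.toNat + v'.toNat
  · by_cases hX : h.toNat + v'.toNat = h'.toNat + q.toNat
    · rw [sixWeight_eq_zero a₂ b₂ c₂ c₂' (by omega), mul_zero]
    · rw [sixWeight_eq_zero a₁ b₁ c₁ c₁' hX, mul_zero, zero_mul]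
  · rw [sixWeight_eq_zero a₃ b₃ c₃ c₃' hW, zero_mul, zero_mul]

/-- The 20V weights `ω₀, …, ω₆` of a triangle of three symmetric six-vertex crossings with the same
weight `s` of the turns. -/
noncomputable def triangleOmega (s a₁ b₁ a₂ b₂ a₃ b₃ : ℂ) : Fin 7 → ℂ :=
  ![a₁ * a₃ * a₂, b₁ * b₃ * a₂, s * b₁ * a₂, s ^ 3 + a₁ * b₃ * b₂, s * a₃ * a₂, s * b₁ * a₃,
    b₁ * a₃ * b₂]

theorem triangleUpper_sixWeight_eq_weight20V {s a₁ b₁ a₂ b₂ a₃ b₃ : ℂ}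
    (ha : s * a₁ + b₂ * b₃ = a₂ * a₃) (hc : a₁ * b₂ + s * b₃ = b₁ * a₂)
    (hb : a₁ * b₃ + s * b₂ = b₁ * a₃) (h v d p q u : Bool) :
    triangleUpper (sixWeight a₁ b₁ s s) (sixWeight a₂ b₂ s s) (sixWeight a₃ b₃ s s) h v d p q u =
      weight20V (triangleOmega s a₁ b₁ a₂ b₂ a₃ b₃) v d h p u q := by
  cases h <;> cases v <;> cases d <;> cases p <;> cases q <;> cases u <;>
    simp only [triangleUpper, Fintype.sum_bool, sixWeight, mul_zero, zero_mul, add_zero, zero_add,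
      weight20V, triangleOmega, Matrix.cons_val] <;>
    grind only

theorem rowWeight_smul {R : Type*} [CommSemiring R] {n : ℕ} (y : R) (M : ℕ → NodeWeight R)
    (c : Config n) : rowWeight (fun r => y • M r) c = y ^ n ^ 2 * rowWeight M c := by
  simp only [rowWeight, Pi.smul_apply, smul_eq_mul, Finset.prod_mul_distrib, Finset.prod_const,
    Finset.card_univ, Fintype.card_fin]
  rw [← pow_mul, sq]

/-- Parameters of a triangle of six-vertex crossings: `a₁` and `b₁` are the weights of a horizontal
and a vertical line, `a₃` and `b₃` those of a diagonal and a vertical line, `s` is the weight of a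
turn. Both pairs lie on the same quadric `a² + b² - 2kab = s²`. In the trigonometric
parametrization, `s = sin φ`, `k = cos φ`, `a = sin (x + φ)` and `b = sin x`. -/
structure TriangleParams where
  s : ℂ
  k : ℂ
  a₁ : ℂ
  b₁ : ℂ
  a₃ : ℂ
  b₃ : ℂ
  s_ne_zero : s ≠ 0
  quadric₁ : a₁ ^ 2 + b₁ ^ 2 - 2 * k * a₁ * b₁ = s ^ 2
  quadric₃ : a₃ ^ 2 + b₃ ^ 2 - 2 * k * a₃ * b₃ = s ^ 2

namespace TriangleParams

variable (P : TriangleParams)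

/-- The weight of no or two paths at the crossing of a diagonal line and a horizontal line, when the
straight weight of the horizontal line with the vertical lines is `B`. -/
noncomputable def alpha (B : ℂ) : ℂ := (B * P.b₃ - P.a₁ * (2 * P.k * P.b₃ - P.a₃)) / P.s

/-- The weight of a straight path at the crossing of a diagonal line and a horizontal line, when the
straight weight of the horizontal line with the vertical lines is `B`. -/
noncomputable def beta (B : ℂ) : ℂ := (B * P.a₃ - P.a₁ * P.b₃) / P.s

/-- The weight of the second kind of turn along a horizontal line whose straight weight with the
vertical lines is `B`. -/
noncomputable def gamma (B : ℂ) : ℂ := (P.a₁ ^ 2 + B ^ 2 - 2 * P.k * P.a₁ * B) / P.s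

/-- The weight `a` of the homogeneous crossings of diagonal and horizontal lines. -/
noncomputable def a₂ : ℂ := P.alpha P.b₁

/-- The weight `b` of the homogeneous crossings of diagonal and horizontal lines. -/
noncomputable def b₂ : ℂ := P.beta P.b₁

theorem s_mul_alpha (B : ℂ) :
    P.s * P.alpha B = B * P.b₃ - P.a₁ * (2 * P.k * P.b₃ - P.a₃) :=
  mul_div_cancel₀ _ P.s_ne_zero

theorem s_mul_beta (B : ℂ) : P.s * P.beta B = B * P.a₃ - P.a₁ * P.b₃ :=
  mul_div_cancel₀ _ P.s_ne_zero

theorem s_mul_gamma (B : ℂ) : P.s * P.gamma B = P.a₁ ^ 2 + B ^ 2 - 2 * P.k * P.a₁ * B :=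
  mul_div_cancel₀ _ P.s_ne_zero

theorem gamma_b₁ : P.gamma P.b₁ = P.s :=
  mul_left_cancel₀ P.s_ne_zero (by rw [s_mul_gamma, quadric₁, sq])

theorem s_mul_a₁_add (B : ℂ) : P.s * P.a₁ + P.beta B * P.b₃ = P.alpha B * P.a₃ :=
  mul_left_cancel₀ P.s_ne_zero <| by
    linear_combination P.b₃ * P.s_mul_beta B - P.a₃ * P.s_mul_alpha B - P.a₁ * P.quadric₃

theorem a₁_mul_beta_add (B : ℂ) : P.a₁ * P.beta B + P.gamma B * P.b₃ = B * P.alpha B :=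
  mul_left_cancel₀ P.s_ne_zero <| by
    linear_combination P.a₁ * P.s_mul_beta B + P.b₃ * P.s_mul_gamma B - B * P.s_mul_alpha B

theorem a₁_mul_b₃_add (B : ℂ) : P.a₁ * P.b₃ + P.s * P.beta B = B * P.a₃ := by
  rw [s_mul_beta]
  ring

/-- Crossings of a vertical line with a horizontal line of straight weight `B`. -/
noncomputable def horizVert (B : ℂ) : PairWeight ℂ := sixWeight P.a₁ B P.s (P.gamma B)

/-- Crossings of a diagonal line with a horizontal line of straight weight `B` (its straight weight
with the vertical lines). -/
noncomputable def horizDiag (B : ℂ) : PairWeight ℂ :=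
  sixWeight (P.alpha B) (P.beta B) P.s (P.gamma B)

/-- Crossings of diagonal and vertical lines. -/
def diagVert : PairWeight ℂ := sixWeight P.a₃ P.b₃ P.s P.s

theorem triangleUpper_eq_triangleLower (B : ℂ) :
    triangleUpper (P.horizVert B) (P.horizDiag B) P.diagVert =
      triangleLower (P.horizVert B) (P.horizDiag B) P.diagVert :=
  triangleUpper_sixWeight_eq_triangleLower (P.s_mul_a₁_add B) (P.a₁_mul_beta_add B)
    (P.a₁_mul_b₃_add B)

/-- The weight of a node on a horizontal line of straight weight `B`: a triangle of crossings, in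
which the weight `a` of the diagonal with the horizontal line is normalized to its homogeneous value
`a₂`. -/
noncomputable def nodeWeight (B : ℂ) : NodeWeight ℂ :=
  (P.a₂ * (P.alpha B)⁻¹) • triangleUpper (P.horizVert B) (P.horizDiag B) P.diagVert

theorem nodeWeight_eq_zero (B : ℂ) {h v d p q u : Bool}
    (hne : h.toNat + v.toNat + d.toNat ≠ p.toNat + q.toNat + u.toNat) :
    P.nodeWeight B h v d p q u = 0 :=
  mul_eq_zero_of_right _ (triangleUpper_sixWeight_eq_zero hne)

open Classical in
theorem sum_rowWeight_nodeWeight {n : ℕ} {B : ℕ → ℂ} (hB : ∀ r, P.alpha (B r) ≠ 0)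
    (ha₃ : P.a₃ ≠ 0) :
    ∑ c : Config n with DWBC2 c, rowWeight (fun r => P.nodeWeight (B r)) c =
      (P.a₂ * P.a₃) ^ n ^ 2 *
        ∑ e : Config6V n with DWBC6V e, rowWeight6V (fun r => P.horizVert (B r)) e := by
  have nodeWeight_eq : ∀ r, P.nodeWeight (B r) = (P.a₂ * P.a₃) • triangleUpper
      (P.horizVert (B r)) ((P.alpha (B r))⁻¹ • P.horizDiag (B r)) (P.a₃⁻¹ • P.diagVert) := by
    intro r
    rw [triangleUpper_smul, smul_smul, nodeWeight]
    congr 1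
    field_simp
  simp only [nodeWeight_eq, rowWeight_smul]
  rw [← Finset.mul_sum, sum_rowWeight_triangleUpper]
  · intro r
    rw [triangleUpper_smul, triangleLower_smul, triangleUpper_eq_triangleLower]
  · exact fun r => isFrozen_inv_smul_sixWeight (hB r) _ _ _
  · exact isFrozen_inv_smul_sixWeight ha₃ _ _ _

/-- The 20V weights `ω₀, …, ω₆` of the homogeneous triangle. -/
noncomputable def omega : Fin 7 → ℂ := triangleOmega P.s P.a₁ P.b₁ P.a₂ P.b₂ P.a₃ P.b₃

theorem nodeWeight_b₁ (ha₂ : P.a₂ ≠ 0) (h v d p q u : Bool) :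
    P.nodeWeight P.b₁ h v d p q u = weight20V P.omega v d h p u q := by
  have ha : P.s * P.a₁ + P.b₂ * P.b₃ = P.a₂ * P.a₃ := P.s_mul_a₁_add P.b₁
  have hc : P.a₁ * P.b₂ + P.s * P.b₃ = P.b₁ * P.a₂ := P.gamma_b₁ ▸ P.a₁_mul_beta_add P.b₁
  rw [nodeWeight, horizVert, horizDiag, diagVert, gamma_b₁, ← a₂, ← b₂, mul_inv_cancel₀ ha₂,
    one_smul, triangleUpper_sixWeight_eq_weight20V ha hc (P.a₁_mul_b₃_add P.b₁), omega]

end TriangleParams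

/-! ## Changing the weights of the top line -/

section TopLine

variable {R : Type*} [CommSemiring R] {n : ℕ}

theorem prod_ite_lt_eq (L : Fin n) (τ x : R) :
    ∏ i : Fin n, (if i < L then τ else if i = L then x else 1) = τ ^ L.val * x := by
  have split_factor : ∀ i : Fin n, (if i < L then τ else if i = L then x else 1) =
      (if i < L then τ else 1) * (if i = L then x else 1) := fun i => by
    rcases lt_trichotomy i L with hi | rfl | hi
    · simp [hi, hi.ne]
    · simp
    · simp [hi.not_gt, hi.ne']
  simp only [split_factor, Finset.prod_mul_distrib, Finset.prod_ite_eq', Finset.mem_univ, if_true]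
  rw [← Finset.prod_filter, Finset.prod_const, Finset.filter_gt_eq_Iio, Fin.card_Iio]

theorem prod_prod_eq_of_top {m : ℕ} {w w' : Fin m → Fin (n + 1) → R} {f : Fin m → R}
    (h_top : ∀ i, w i (Fin.last n) = f i * w' i (Fin.last n))
    (h_lower : ∀ i (j : Fin n), w i j.castSucc = w' i j.castSucc) :
    ∏ i, ∏ j, w i j = (∏ i, f i) * ∏ i, ∏ j, w' i j := by
  simp only [Fin.prod_univ_castSucc, h_top, h_lower, ← Finset.prod_mul_distrib]
  exact Finset.prod_congr rfl fun i _ => mul_left_comm _ _ _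

end TopLine

open Classical in
theorem Ztop_eq_sum_filter (n : ℕ) (ω : Fin 7 → ℂ) (b : Out) (L : Fin n) :
    Ztop n ω b L = ∑ c : Config n with IsConfig20V c,
      if LeavesTop c L b then totalWeight20V ω c else 0 := by
  simp only [Ztop, ite_and, Finset.sum_filter]

open Classical in
theorem Z6V_eq_sum_filter (n : ℕ) (a b c : ℂ) (L : Fin n) :
    Z6V n a b c L = ∑ e : Config6V n with IsConfig6V e,
      if HitsRight6V (transpose6V n e) L then
        ∏ i : Fin n, ∏ j : Fin n, weight6V a b c (inEdge6V e i j .north) (inEdge6V e i j .west)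
          (outEdge6V e i j .east) (outEdge6V e i j .south) else 0 := by
  rw [Z6V, ← (transpose6V n).sum_comp]
  simp only [isConfig6V_transpose_iff, prod_weight6V_transpose, ite_and, Finset.sum_filter]

namespace TriangleParams

variable (P : TriangleParams) {n : ℕ} (σ : ℂ)

/-- The straight weights of the horizontal lines, from the top, when that of the top line is
multiplied by `σ`. -/
noncomputable def lineWeight : ℕ → ℂ
  | 0 => σ * P.b₁
  | _ + 1 => P.b₁

/-- The weight of a step of the uppermost path along the top line, relative to the homogeneous
model, when the straight weight of this line is multiplied by `σ`. -/
noncomputable def tau : ℂ := σ * P.beta (σ * P.b₁) * P.a₂ / (P.b₂ * P.alpha (σ * P.b₁))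

/-- The weight of a diagonal step of the uppermost path off the top line, relative to the
homogeneous model, when the straight weight of this line is multiplied by `σ`. -/
noncomputable def leavingFactor : ℂ := σ * P.a₂ / P.alpha (σ * P.b₁)

theorem nodeWeight_of_empty_above {σ : ℂ} (hb₂ : P.b₂ ≠ 0) (hσ : P.alpha (σ * P.b₁) ≠ 0)
    {h p q u : Bool} (h_ice : h.toNat = p.toNat + q.toNat + u.toNat) :
    P.nodeWeight (σ * P.b₁) h false false p q u =
      (if p then P.tau σ else if u then P.leavingFactor σ else 1) *
        weight20V P.omega false false h p u q := by
  cases h <;> cases p <;> cases q <;> cases u <;> cases h_ice <;>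
    simp only [nodeWeight, Pi.smul_apply, smul_eq_mul, triangleUpper, Fintype.sum_bool, horizVert,
      horizDiag, diagVert, sixWeight, mul_zero, zero_mul, add_zero, zero_add, if_true,
      Bool.false_eq_true, if_false, tau, leavingFactor, weight20V, omega, triangleOmega,
      Matrix.cons_val] <;>
    field_simp

theorem nodeWeight_topRow {σ : ℂ} (hb₂ : P.b₂ ≠ 0) (hσ : P.alpha (σ * P.b₁) ≠ 0)
    {c : Config (n + 1)} {L : Fin (n + 1)} {b : Bool} (h : TopRow c L b) (i : Fin (n + 1)) :
    P.nodeWeight (σ * P.b₁) (inEdge c i (Fin.last n) .west) (inEdge c i (Fin.last n) .north)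
        (inEdge c i (Fin.last n) .northwest) (outEdge c i (Fin.last n) .east)
        (outEdge c i (Fin.last n) .south) (outEdge c i (Fin.last n) .southeast) =
      (if i < L then P.tau σ else if i = L then (if b then P.leavingFactor σ else 1) else 1) *
        weight20V P.omega (inEdge c i (Fin.last n) .north) (inEdge c i (Fin.last n) .northwest)
          (inEdge c i (Fin.last n) .west) (outEdge c i (Fin.last n) .east)
          (outEdge c i (Fin.last n) .southeast) (outEdge c i (Fin.last n) .south) := by
  rw [h.north, h.northwest, h.west, h.east, h.southeast, h.south]
  rcases lt_trichotomy i L with hi | rfl | hi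
  · rw [P.nodeWeight_of_empty_above hb₂ hσ] <;> simp [hi, hi.le, hi.ne]
  · cases b <;> rw [P.nodeWeight_of_empty_above hb₂ hσ] <;> simp
  · rw [P.nodeWeight_of_empty_above hb₂ hσ] <;> simp [hi.not_gt, hi.not_ge, hi.ne']

theorem rowWeight_nodeWeight {σ : ℂ} (ha₂ : P.a₂ ≠ 0) (hb₂ : P.b₂ ≠ 0)
    (hσ : P.alpha (σ * P.b₁) ≠ 0) {c : Config (n + 1)} {L : Fin (n + 1)} {b : Bool}
    (h : TopRow c L b) :
    rowWeight (fun r => P.nodeWeight (P.lineWeight σ r)) c =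
      P.tau σ ^ L.val * (if b then P.leavingFactor σ else 1) * totalWeight20V P.omega c := by
  rw [rowWeight, totalWeight20V, ← prod_ite_lt_eq]
  refine prod_prod_eq_of_top (fun i => ?_) fun i j => ?_
  · rw [Fin.rev_last]
    exact P.nodeWeight_topRow hb₂ hσ h i
  · rw [Fin.rev_castSucc]
    exact P.nodeWeight_b₁ ha₂ _ _ _ _ _ _

theorem rowWeight_eq_zero {c : Config n} (hc : DWBC2 c) (h : ¬IsConfig20V c) :
    rowWeight (fun r => P.nodeWeight (P.lineWeight σ r)) c = 0 := by
  obtain ⟨i, j, hij⟩ : ∃ i j, ¬IceRule c i j := by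
    by_contra! h_ice
    exact h ⟨hc, h_ice⟩
  refine Finset.prod_eq_zero (Finset.mem_univ i) (Finset.prod_eq_zero (Finset.mem_univ j)
    (P.nodeWeight_eq_zero _ fun h_eq => hij ?_))
  rw [IceRule]
  omega

open Classical in
theorem sum_rowWeight_eq_ZtopRefined {σ : ℂ} (ha₂ : P.a₂ ≠ 0) (hb₂ : P.b₂ ≠ 0)
    (hσ : P.alpha (σ * P.b₁) ≠ 0) :
    ∑ c : Config (n + 1) with DWBC2 c, rowWeight (fun r => P.nodeWeight (P.lineWeight σ r)) c =
      ZtopRefined (n + 1) P.omega .south (P.tau σ) +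
        P.leavingFactor σ * ZtopRefined (n + 1) P.omega .southeast (P.tau σ) := by
  have restrict : ∑ c : Config (n + 1) with DWBC2 c,
        rowWeight (fun r => P.nodeWeight (P.lineWeight σ r)) c =
      ∑ c : Config (n + 1) with IsConfig20V c,
        rowWeight (fun r => P.nodeWeight (P.lineWeight σ r)) c := by
    refine (Finset.sum_subset (Finset.monotone_filter_right _ fun c _ hc => hc.1)
      fun c hc h => P.rowWeight_eq_zero σ (Finset.mem_filter.1 hc).2 ?_).symm
    simpa using h
  simp only [restrict, ZtopRefined, Ztop_eq_sum_filter, Finset.sum_mul, Finset.mul_sum]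
  rw [Finset.sum_comm, Finset.sum_comm (γ := Fin (n + 1)), ← Finset.sum_add_distrib]
  refine Finset.sum_congr rfl fun c hc => ?_
  obtain ⟨L, b, h⟩ := exists_topRow (Finset.mem_filter.1 hc).2
  have south_iff (L') : LeavesTop c L' .south ↔ L' = L ∧ false = b := h.leavesTop_iff (b' := false)
  have southeast_iff (L') : LeavesTop c L' .southeast ↔ L' = L ∧ true = b :=
    h.leavesTop_iff (b' := true)
  rw [P.rowWeight_nodeWeight ha₂ hb₂ hσ h]
  cases b <;> simp [south_iff, southeast_iff, mul_comm, mul_left_comm]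

theorem rowWeight6V_horizVert {e : Config6V (n + 1)} {L : Fin (n + 1)} (h : TopRow6V e L) :
    rowWeight6V (fun r => P.horizVert (P.lineWeight σ r)) e =
      σ ^ L.val * ∏ i : Fin (n + 1), ∏ j : Fin (n + 1), weight6V P.a₁ P.b₁ P.s
        (inEdge6V e i j .north) (inEdge6V e i j .west) (outEdge6V e i j .east)
        (outEdge6V e i j .south) := by
  rw [rowWeight6V, ← mul_one (σ ^ L.val), ← prod_ite_lt_eq]
  refine prod_prod_eq_of_top (fun i => ?_) fun i j => ?_
  · rw [Fin.rev_last, h.north, h.west, h.east, h.south]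
    rcases lt_trichotomy i L with hi | rfl | hi
    · simp [hi, hi.le, hi.ne, horizVert, lineWeight, sixWeight, weight6V]
    · simp [horizVert, sixWeight, weight6V]
    · simp [hi.not_gt, hi.not_ge, hi.ne', horizVert, sixWeight, weight6V]
  · have sixWeight_eq_weight6V : ∀ W N E S, sixWeight P.a₁ P.b₁ P.s P.s W N E S =
        weight6V P.a₁ P.b₁ P.s N W E S := by
      rintro (_ | _) (_ | _) (_ | _) (_ | _) <;> rfl
    simp only [Fin.rev_castSucc, Fin.val_succ, lineWeight, horizVert, gamma_b₁,
      sixWeight_eq_weight6V]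

theorem rowWeight6V_eq_zero {e : Config6V n} (he : DWBC6V e) (h : ¬IsConfig6V e) :
    rowWeight6V (fun r => P.horizVert (P.lineWeight σ r)) e = 0 := by
  obtain ⟨i, j, hij⟩ : ∃ i j, (inEdge6V e i j .north).toNat + (inEdge6V e i j .west).toNat ≠
      (outEdge6V e i j .east).toNat + (outEdge6V e i j .south).toNat := by
    by_contra! h_ice
    exact h ⟨he.left, he.right, he.bottom, he.top, h_ice⟩
  exact Finset.prod_eq_zero (Finset.mem_univ i) (Finset.prod_eq_zero (Finset.mem_univ j)
    (sixWeight_eq_zero _ _ _ _ (by omega)))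

open Classical in
theorem sum_rowWeight6V_eq_Z6V :
    ∑ e : Config6V (n + 1) with DWBC6V e, rowWeight6V (fun r => P.horizVert (P.lineWeight σ r)) e =
      ∑ L : Fin (n + 1), Z6V (n + 1) P.a₁ P.b₁ P.s L * σ ^ L.val := by
  have restrict : ∑ e : Config6V (n + 1) with DWBC6V e,
        rowWeight6V (fun r => P.horizVert (P.lineWeight σ r)) e =
      ∑ e : Config6V (n + 1) with IsConfig6V e,
        rowWeight6V (fun r => P.horizVert (P.lineWeight σ r)) e := by
    refine (Finset.sum_subset (Finset.monotone_filter_right _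
      fun e _ he => ⟨he.left, he.right, he.bottom, he.top⟩)
      fun e he h => P.rowWeight6V_eq_zero σ (Finset.mem_filter.1 he).2 ?_).symm
    simpa using h
  simp only [restrict, Z6V_eq_sum_filter, Finset.sum_mul]
  rw [Finset.sum_comm]
  refine Finset.sum_congr rfl fun e he => ?_
  have he := (Finset.mem_filter.1 he).2
  obtain ⟨L, h⟩ := exists_topRow6V he
  simp only [P.rowWeight6V_horizVert σ h, h.hitsRight_transpose_iff he, ite_mul, zero_mul,
    Finset.sum_ite_eq', Finset.mem_univ, if_true]
  exact mul_comm _ _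

theorem ZtopRefined_add_leavingFactor_mul {σ : ℂ} (ha₂ : P.a₂ ≠ 0) (hb₂ : P.b₂ ≠ 0)
    (ha₃ : P.a₃ ≠ 0) (hσ : P.alpha (σ * P.b₁) ≠ 0) (n : ℕ) :
    ZtopRefined n P.omega .south (P.tau σ) +
        P.leavingFactor σ * ZtopRefined n P.omega .southeast (P.tau σ) =
      (P.a₂ * P.a₃) ^ n ^ 2 * ∑ L : Fin n, Z6V n P.a₁ P.b₁ P.s L * σ ^ L.val := by
  cases n with
  | zero => simp [ZtopRefined]
  | succ n =>
    have alpha_ne_zero : ∀ r, P.alpha (P.lineWeight σ r) ≠ 0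
      | 0 => hσ
      | _ + 1 => ha₂
    rw [← P.sum_rowWeight_eq_ZtopRefined ha₂ hb₂ hσ, P.sum_rowWeight_nodeWeight alpha_ne_zero ha₃,
      P.sum_rowWeight6V_eq_Z6V]

end TriangleParams

/-! ## Trigonometric weights -/

section Trigonometric

open Complex

theorem sin_add_sq_add_sin_sq (x φ : ℂ) :
    sin (x + φ) ^ 2 + sin x ^ 2 - 2 * cos φ * sin (x + φ) * sin x = sin φ ^ 2 := by
  rw [sin_add]
  linear_combination sin φ ^ 2 * sin_sq_add_cos_sq x - sin x ^ 2 * sin_sq_add_cos_sq φ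

theorem sin_mul_sin_sub_add (y u φ : ℂ) :
    sin φ * sin (y - u + φ) = sin y * sin u - sin (y + φ) * sin (u - φ) := by
  simp only [sin_add, sin_sub, cos_sub]
  linear_combination sin y * sin u * sin_sq_add_cos_sq φ

theorem sin_mul_sin_sub (y u φ : ℂ) :
    sin φ * sin (y - u) = sin y * sin (u + φ) - sin (y + φ) * sin u := by
  simp only [sin_add, sin_sub]
  ring

theorem two_mul_cos_mul_sin_sub_sin_add (x φ : ℂ) :
    2 * cos φ * sin x - sin (x + φ) = sin (x - φ) := by
  rw [sin_sub, sin_add]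
  ring

theorem exp_I_mul_sub_exp_I_mul (x y : ℂ) :
    exp (I * x) - exp (I * y) = 2 * I * exp (I * ((x + y) / 2)) * sin ((x - y) / 2) := by
  have exp_left : exp (I * x) = exp (I * ((x + y) / 2)) * exp ((x - y) / 2 * I) := by
    rw [← exp_add]
    ring_nf
  have exp_right : exp (I * y) = exp (I * ((x + y) / 2)) * exp (-((x - y) / 2) * I) := by
    rw [← exp_add]
    ring_nf
  rw [exp_left, exp_right, sin]
  linear_combination (exp (I * ((x + y) / 2)) *
    (exp ((x - y) / 2 * I) - exp (-((x - y) / 2) * I))) * I_sq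

theorem a₂_eq (η lam μ : ℂ) :
    a₂ η lam μ = exp (I * ((lam + η + μ) / 2)) / tCubeRoot μ * sin ((lam + 3 * η - μ) / 2) := by
  have difference : exp (I * η) * exp (I * (η + lam)) - (exp (I * η))⁻¹ * exp (I * μ) =
      2 * I * exp (I * ((lam + η + μ) / 2)) * sin ((lam + 3 * η - μ) / 2) := by
    convert exp_I_mul_sub_exp_I_mul (2 * η + lam) (μ - η) using 2
    · rw [← exp_add]; ring_nf
    · rw [← exp_neg, ← exp_add]; ring_nf
    · ring_nf
    · ring_nf
  rw [a₂, difference]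
  field_simp

theorem a₃_eq (η lam μ : ℂ) :
    a₃ η lam μ = exp (I * ((μ - η - lam) / 2)) / tCubeRoot μ * sin ((lam + 3 * η + μ) / 2) := by
  have difference : exp (I * η) * exp (I * μ) - (exp (I * η))⁻¹ * exp (-(I * (η + lam))) =
      2 * I * exp (I * ((μ - η - lam) / 2)) * sin ((lam + 3 * η + μ) / 2) := by
    convert exp_I_mul_sub_exp_I_mul (η + μ) (-(2 * η + lam)) using 2
    · rw [← exp_add]; ring_nf
    · rw [← exp_neg, ← exp_add]; ring_nf
    · ring_nf
    · ring_nf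
  rw [a₃, difference]
  field_simp

theorem a₂_mul_a₃_div_tCubeRoot (η lam μ : ℂ) : a₂ η lam μ * a₃ η lam μ / tCubeRoot μ =
    sin ((lam + 3 * η - μ) / 2) * sin ((lam + 3 * η + μ) / 2) := by
  have tCubeRoot_ne_zero : tCubeRoot μ ≠ 0 := exp_ne_zero _
  have tCubeRoot_pow : exp (I * ((lam + η + μ) / 2)) * exp (I * ((μ - η - lam) / 2)) =
      tCubeRoot μ ^ 3 := by
    rw [tCubeRoot, ← exp_add, ← exp_nat_mul]
    ring_nf
  calc a₂ η lam μ * a₃ η lam μ / tCubeRoot μ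
      = exp (I * ((lam + η + μ) / 2)) * exp (I * ((μ - η - lam) / 2)) / tCubeRoot μ ^ 3 *
          (sin ((lam + 3 * η - μ) / 2) * sin ((lam + 3 * η + μ) / 2)) := by
        rw [a₂_eq, a₃_eq]
        ring
    _ = sin ((lam + 3 * η - μ) / 2) * sin ((lam + 3 * η + μ) / 2) := by
        rw [tCubeRoot_pow, div_self (pow_ne_zero 3 tCubeRoot_ne_zero), one_mul]

/-- The trigonometric weights of the 20V model: the crossings of horizontal and vertical lines are
those of the 6V model. -/
noncomputable def trigParams (η lam μ : ℂ) (h : sin (2 * η) ≠ 0) : TriangleParams where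
  s := sin (2 * η)
  k := cos (2 * η)
  a₁ := sin (lam + η)
  b₁ := sin (lam - η)
  a₃ := sin ((lam + 3 * η + μ) / 2)
  b₃ := sin ((lam - η + μ) / 2)
  s_ne_zero := h
  quadric₁ := by
    convert sin_add_sq_add_sin_sq (lam - η) (2 * η) using 5 <;> ring
  quadric₃ := by
    convert sin_add_sq_add_sin_sq ((lam - η + μ) / 2) (2 * η) using 5 <;> ring

namespace trigParams

variable {η lam μ : ℂ} (h : sin (2 * η) ≠ 0) (σ : ℂ)

theorem alpha_eq : (trigParams η lam μ h).alpha (σ * (trigParams η lam μ h).b₁) =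
    denomTilde η lam μ σ / sin (2 * η) := by
  have two_mul_cos := two_mul_cos_mul_sin_sub_sin_add ((lam - η + μ) / 2) (2 * η)
  rw [show (lam - η + μ) / 2 + 2 * η = (lam + 3 * η + μ) / 2 by ring,
    show (lam - η + μ) / 2 - 2 * η = (lam - 5 * η + μ) / 2 by ring] at two_mul_cos
  rw [denomTilde, ← two_mul_cos]
  rfl

theorem a₂_eq_sin : (trigParams η lam μ h).a₂ = sin ((lam + 3 * η - μ) / 2) := by
  have sin_mul := sin_mul_sin_sub_add (lam - η) ((lam - η + μ) / 2) (2 * η)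
  rw [show lam - η - (lam - η + μ) / 2 + 2 * η = (lam + 3 * η - μ) / 2 by ring,
    show lam - η + 2 * η = lam + η by ring,
    show (lam - η + μ) / 2 - 2 * η = (lam - 5 * η + μ) / 2 by ring] at sin_mul
  have alpha_one := alpha_eq (lam := lam) (μ := μ) h 1
  rw [one_mul] at alpha_one
  rw [TriangleParams.a₂, alpha_one, denomTilde, one_mul, ← sin_mul, mul_div_cancel_left₀ _ h]

theorem b₂_eq_sin : (trigParams η lam μ h).b₂ = sin ((lam - η - μ) / 2) := by
  have sin_mul := sin_mul_sin_sub (lam - η) ((lam - η + μ) / 2) (2 * η)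
  rw [show lam - η - (lam - η + μ) / 2 = (lam - η - μ) / 2 by ring,
    show lam - η + 2 * η = lam + η by ring,
    show (lam - η + μ) / 2 + 2 * η = (lam + 3 * η + μ) / 2 by ring] at sin_mul
  rw [eq_div_of_mul_eq h ((mul_comm _ _).trans sin_mul)]
  rfl

theorem omega_eq : (trigParams η lam μ h).omega = omega η lam μ := by
  funext i
  rw [TriangleParams.omega, a₂_eq_sin, b₂_eq_sin]
  fin_cases i <;> rfl

theorem tau_eq : (trigParams η lam μ h).tau σ = tauTilde η lam μ σ := by
  rw [TriangleParams.tau, alpha_eq, a₂_eq_sin, b₂_eq_sin, tauTilde, TriangleParams.beta]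
  simp only [trigParams]
  generalize sin (2 * η) = s at h ⊢
  field_simp

theorem leavingFactor_eq : (trigParams η lam μ h).leavingFactor σ = gTilde η lam μ σ := by
  rw [TriangleParams.leavingFactor, alpha_eq, a₂_eq_sin, gTilde]
  field_simp

end trigParams

theorem sin_ofReal_ne_zero {x : ℝ} (h_pos : 0 < x) (h_lt : x < Real.pi) : sin (x : ℂ) ≠ 0 := by
  rw [← ofReal_sin, ofReal_ne_zero]
  exact (Real.sin_pos_of_pos_of_lt_pi h_pos h_lt).ne'

end Trigonometric

end TwentyV

theorem theorem3p2_general (n : ℕ) {η lam μ σ : ℂ} (hs : Complex.sin (2 * η) ≠ 0)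
    (ha₂ : Complex.sin ((lam + 3 * η - μ) / 2) ≠ 0)
    (ha₃ : Complex.sin ((lam + 3 * η + μ) / 2) ≠ 0)
    (hb₂ : Complex.sin ((lam - η - μ) / 2) ≠ 0) (hσ : TwentyV.denomTilde η lam μ σ ≠ 0) :
    TwentyV.ZtopRefined n (TwentyV.omega η lam μ) .south (TwentyV.tauTilde η lam μ σ) +
        TwentyV.gTilde η lam μ σ *
          TwentyV.ZtopRefined n (TwentyV.omega η lam μ) .southeast (TwentyV.tauTilde η lam μ σ) =
      (TwentyV.a₂ η lam μ * TwentyV.a₃ η lam μ / TwentyV.tCubeRoot μ) ^ (n ^ 2) *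
        TwentyV.Z6VRefined n η lam σ := by
  have refined := (TwentyV.trigParams η lam μ hs).ZtopRefined_add_leavingFactor_mul (σ := σ)
    (by rwa [TwentyV.trigParams.a₂_eq_sin]) (by rwa [TwentyV.trigParams.b₂_eq_sin]) ha₃
    (by rw [TwentyV.trigParams.alpha_eq]; exact div_ne_zero hσ hs) n
  rw [TwentyV.trigParams.omega_eq, TwentyV.trigParams.tau_eq, TwentyV.trigParams.leavingFactor_eq,
    TwentyV.trigParams.a₂_eq_sin] at refined
  rw [TwentyV.a₂_mul_a₃_div_tCubeRoot]
  exact refined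

theorem theorem3p2 (n : ℕ) (hn : 1 ≤ n) (η lam μ : ℝ)
    (hη : 0 < η) (hηlam : η < lam) (hlam : lam < Real.pi - η)
    (hμ : η - lam < μ) (hμ' : μ < lam - η)
    (σ : ℂ) (hσ : TwentyV.denomTilde η lam μ σ ≠ 0) :
    TwentyV.ZtopRefined n (TwentyV.omega η lam μ) .south (TwentyV.tauTilde η lam μ σ) +
        TwentyV.gTilde η lam μ σ *
          TwentyV.ZtopRefined n (TwentyV.omega η lam μ) .southeast (TwentyV.tauTilde η lam μ σ) =
      (TwentyV.a₂ η lam μ * TwentyV.a₃ η lam μ / TwentyV.tCubeRoot μ) ^ (n ^ 2) *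
        TwentyV.Z6VRefined n η lam σ := by
  refine theorem3p2_general n ?_ ?_ ?_ ?_ hσ
  · exact_mod_cast TwentyV.sin_ofReal_ne_zero (x := 2 * η) (by linarith) (by linarith)
  · exact_mod_cast TwentyV.sin_ofReal_ne_zero (x := (lam + 3 * η - μ) / 2)
      (by linarith) (by linarith)
  · exact_mod_cast TwentyV.sin_ofReal_ne_zero (x := (lam + 3 * η + μ) / 2)
      (by linarith) (by linarith)
  · exact_mod_cast TwentyV.sin_ofReal_ne_zero (x := (lam - η - μ) / 2) (by linarith) (by linarith)
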